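/- **Protocol.** There are $n$ nodes, of which $\lfloor qn\rfloor$ are Byzantine and the others honest; $k,m_0,\ell\ge 1$ are integers, $\beta\in(0,\tfrac12)$ and $\tfrac12<a\le b<1$. Every honest node starts with an opinion in $\{0,1\}$. In round $m=1,2,\dots$ every honest node $j$ queries $k$ independent uniformly random nodes (repetitions and self-queries allowed) and counts the number $\eta_m(j)$ of answers $1$; honest nodes answer with their current opinion. After that a common random number $X_m$ is revealed, independent of everything so far, uniform on $[a,b]$ if $m=1$ and on $[\beta,1-\beta]$ if $m\ge2$. Each honest node without a final opinion adopts opinion $1$ if $\eta_m(j)/k\ge X_m$ and opinion $0$ otherwise. An opinion that a node has had in $\ell$ consecutive rounds, counting from round $m_0+1$ on, becomes final. The adversary knows everything that has happened so far, may randomize, and does not know $X_m$ when he answers in round $m$. He is *cautious* if, before the queries of a round are made, he fixes an opinion for each of his nodes, which this node then gives as the answer to all queries of the round; he is *berserk* if there is no such restriction and each query may be answered differently. We say that *the protocol works whp* for $(q,\beta,a,b)$ against a kind of adversary if for every $\varepsilon>0$ there are $m_0,\ell,u\ge1$ and $k=k(n)$ with $k(n)\to\infty$, $k(n)/n\to0$,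 such that for all large enough $n$, for all initial opinions and all strategies of this kind of adversary, with probability at least $1-\varepsilon$ all honest nodes reach the same final opinion within $m_0+\ell u$ rounds. **Security estimate.** Put $e_k=e^{-\frac12k(\beta-q)^2}$, $\varphi_k=\frac{\beta-q}{2(1-q)}-e_k$, $$W=(1-q)n\Big(\big(1-(1-e_k)^\ell\big)^u+\Big(\frac{e_k}{1-e_k}\Big)^{\ell-1}\Big)+(m_0+\ell u)e^{-2(1-q)n\varphi_k^2},$$ $$\psi_{cau}=2e^{-\frac n8\frac{(\beta-q)^2}{4(1-q)}}+\frac{\sqrt{2k^{-1}\ln\frac{4(1-q)}{\beta-q}}}{1-2\beta},\qquad \psi_{ber}=2e^{-\frac n8\frac{(\beta-q)^2}{4(1-q)}}+\frac{q+\sqrt{2k^{-1}\ln\frac{4(1-q)}{\beta-q}}}{1-2\beta}.$$ We say that *the security estimate works* for $(q,\beta)$ against a cautious (berserk) adversary if for every $\varepsilon>0$ there are $m_0,\ell,u\ge1$ and $k=k(n)$ with $k(n)\to\infty$, $k(n)/n\to0$, such that for all large enough $n$ one has $\varphi_k>0$ and $1-W-\psi^{m_0}\ge1-\varepsilon$,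 where $\psi=\psi_{cau}$ ($\psi=\psi_{ber}$). **Corollary.** 1. Let $0\le q<1$ and $0<\beta<\frac12$. The security estimate works against a cautious adversary if and only if $q<\beta$, and against a berserk adversary if and only if $q<\beta$ and $q<1-2\beta$. 2. Let $0\le q<\beta<\frac12$ and $\frac12<a\le b<1$. The protocol works whp against a cautious adversary. It works whp against a berserk adversary if and only if $q<1-2\beta$. 3. (Cautious adversary.) For every $q\in[0,\frac12)$ there is $\beta_0<\frac12$ such that for all $\beta\in(\beta_0,\frac12)$ the security estimate works and, for all $\frac12<a\le b<1$, the protocol works whp against a cautious adversary. 4. (Berserk adversary.) For every $q\in[0,\frac13)$, with $\beta=\frac13$, the security estimate works and, for all $\frac12<a\le b<1$, the protocol works whp against a berserk adversary. 5. (Berserk adversary, threshold.) Let $0\le q<1$. There is $\beta\in(0,\frac12)$ for which the security estimate works against a berserk adversary if and only if $q<\frac13$. For all $\frac12<a\le b<1$, there is $\beta\in(q,\frac12)$ for which the protocol works whp against a berserk adversary if and only if $q<\frac13$. -/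

import Mathlib

open MeasureTheory Filter Topology

namespace RandomThreshold

/-- The two kinds of adversary. -/
inductive AdversaryKind
  | cautious
  | berserk

/-! ### The protocol

There are `h` honest and `f` Byzantine nodes. In each round every honest node makes `k` queries.
Time index `t : ℕ` stands for round number `t + 1`. -/

/-- A node: honest (`Sum.inl`) or Byzantine (`Sum.inr`). -/
abbrev Node (h f : ℕ) := Fin h ⊕ Fin f

/-- The queries of one round: `Q j i` is the node that receives the `i`-th query of honest
node `j`. -/
abbrev Queries (h f k : ℕ) := Fin h → Fin k → Node h f

/-- All randomness of one round: the common random number (as a number in `[0,1]`, to be rescaled),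
the private random number of the adversary, and the queries. -/
abbrev RoundNoise (h f k : ℕ) := (unitInterval × unitInterval) × Queries h f k

/-- The law of the randomness of one round: everything is independent, the two numbers are uniform
on `[0,1]`, and every query goes to a uniformly chosen node (repetitions and self-queries are
allowed). -/
noncomputable def roundLaw (h f k : ℕ) : Measure (RoundNoise h f k) :=
  ((volume : Measure unitInterval).prod (volume : Measure unitInterval)).prod
    (Measure.pi fun _ : Fin h => Measure.pi fun _ : Fin k =>
      ProbabilityTheory.uniformOn (Set.univ : Set (Node h f)))

/-- The law of the whole randomness: the rounds are independent. -/
noncomputable def law (h f k : ℕ) : Measure (ℕ → RoundNoise h f k) :=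
  Measure.infinitePi fun _ => roundLaw h f k

/-- A strategy of an omniscient, not prescient adversary. `answer t past s Q j i z` is the answer
of Byzantine node `z`, at time `t`, to the `i`-th query of honest node `j`. It may depend on
everything that happened in the earlier rounds (which determines the current opinions of all honest
nodes), on private randomness `s`, and on all queries `Q` of the current round, but not on the
common random number of the current round, nor on the future. -/
structure Strategy (h f k : ℕ) where
  answer : (t : ℕ) → (Fin t → RoundNoise h f k) → unitInterval → Queries h f k →
    Fin h → Fin k → Fin f → Bool
  measurable_answer : ∀ t, Measurable
    fun x : (Fin t → RoundNoise h f k) × unitInterval × Queries h f k =>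
      answer t x.1 x.2.1 x.2.2

/-- A cautious adversary fixes the opinion of each of his nodes before the queries of the round are
made, and this opinion is the answer to all queries of the round. A berserk adversary is
unrestricted. -/
def Strategy.Allowed {h f k : ℕ} (S : Strategy h f k) : AdversaryKind → Prop
  | .cautious => ∀ t past s Q Q' j j' i i' z,
      S.answer t past s Q j i z = S.answer t past s Q' j' i' z
  | .berserk => True

/-- State of an honest node: its current opinion, and the number of consecutive rounds after the
cooling-off period, up to now, during which it has had this opinion. -/
structure NodeState where
  opinion : Bool
  run : ℕ

/-- The decision threshold at time `t`: uniform on `[a,b]` in the first round and on `[β,1-β]` in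
the later rounds. -/
noncomputable def threshold (a b β : ℝ) (t : ℕ) (x : unitInterval) : ℝ :=
  if t = 0 then a + (b - a) * (x : ℝ) else β + (1 - 2 * β) * (x : ℝ)

/-- The number of `1`-answers among the `k` queries of node `j`, when the honest nodes have opinions
`op` and the Byzantine nodes answer according to `ans`. -/
def onesCount {h f k : ℕ} (op : Fin h → Bool) (ans : Fin h → Fin k → Fin f → Bool)
    (Q : Queries h f k) (j : Fin h) : ℕ :=
  (Finset.univ.filter fun i : Fin k => Sum.elim op (ans j i) (Q j i) = true).card

/-- The states of the honest nodes after the first `t` rounds, from initial opinions `init`. An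
opinion held for `ℓ` consecutive rounds, counting from round `m₀ + 1` on, is final. -/
noncomputable def state {h f k : ℕ} (a b β : ℝ) (m₀ ℓ : ℕ) (init : Fin h → Bool)
    (S : Strategy h f k) (ω : ℕ → RoundNoise h f k) : ℕ → Fin h → NodeState
  | 0 => fun j => ⟨init j, 0⟩
  | t + 1 => fun j =>
      let prev := state a b β m₀ ℓ init S ω t
      let Q := (ω t).2
      let ans := S.answer t (fun r : Fin t => ω r) (ω t).1.2 Q
      let η := onesCount (fun i => (prev i).opinion) ans Q j
      let new : Bool :=
        if ℓ ≤ (prev j).run then (prev j).opinion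
        else @decide (threshold a b β t (ω t).1.1 ≤ (η : ℝ) / k) (Classical.dec _)
      ⟨new, if t + 1 ≤ m₀ then 0 else if new = (prev j).opinion then (prev j).run + 1 else 1⟩

/-- The probability that within the first `T` rounds all honest nodes have reached a final opinion,
the same for all of them. -/
noncomputable def consensusProb {h f k : ℕ} (a b β : ℝ) (m₀ ℓ : ℕ) (init : Fin h → Bool)
    (S : Strategy h f k) (T : ℕ) : ℝ :=
  (law h f k).real {ω | ∃ i : Bool, ∀ j : Fin h,
    ℓ ≤ (state a b β m₀ ℓ init S ω T j).run ∧ (state a b β m₀ ℓ init S ω T j).opinion = i}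

/-- The number of Byzantine nodes among `n` nodes, for proportion `q`. -/
noncomputable def numByz (q : ℝ) (n : ℕ) : ℕ := ⌊q * n⌋₊

/-- The protocol with threshold parameter `β` can be made to work with high probability against
adversarial proportion `q`: for every `ε > 0`, with suitable `m₀`, `ℓ`, `u`, and with a number `k`
of queries that grows with `n` but is of smaller order than `n`, for all large `n`, whatever the
initial opinions and the strategy, with probability at least `1 - ε` all honest nodes reach the
same final opinion within `m₀ + ℓ u` rounds. -/
def WorksWhp (kind : AdversaryKind) (q β a b : ℝ) : Prop :=
  ∀ ε : ℝ, 0 < ε → ∃ m₀ ℓ u : ℕ, ∃ k : ℕ → ℕ, 1 ≤ m₀ ∧ 1 ≤ ℓ ∧ 1 ≤ u ∧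
    Tendsto k atTop atTop ∧ Tendsto (fun n => (k n : ℝ) / n) atTop (𝓝 0) ∧
    ∀ᶠ n : ℕ in atTop,
      ∀ (init : Fin (n - numByz q n) → Bool)
        (S : Strategy (n - numByz q n) (numByz q n) (k n)),
        S.Allowed kind → 1 - ε ≤ consensusProb a b β m₀ ℓ init S (m₀ + ℓ * u)

/-! ### The explicit security estimate -/

/-- `e^{-k(β-q)²/2}`. -/
noncomputable def err (β q : ℝ) (k : ℕ) : ℝ := Real.exp (-(1 / 2) * k * (β - q) ^ 2)

/-- The quantity `φ_{β,q,k}`. -/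
noncomputable def phi (β q : ℝ) (k : ℕ) : ℝ := (β - q) / (2 * (1 - q)) - err β q k

/-- The quantity `W(n,k,m₀,ℓ,u)`. -/
noncomputable def bigW (β q : ℝ) (n k m₀ ℓ u : ℕ) : ℝ :=
  (1 - q) * n * ((1 - (1 - err β q k) ^ ℓ) ^ u + (err β q k / (1 - err β q k)) ^ (ℓ - 1))
    + (m₀ + ℓ * u) * Real.exp (-2 * (1 - q) * n * phi β q k ^ 2)

/-- The quantities `ψ_cau(n,k)` and `ψ_ber(n,k)`. -/
noncomputable def psi (β q : ℝ) (n k : ℕ) : AdversaryKind → ℝ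
  | .cautious => 2 * Real.exp (-(1 / 8) * n * ((β - q) ^ 2 / (4 * (1 - q))))
      + (1 - 2 * β)⁻¹ * Real.sqrt (2 * (k : ℝ)⁻¹ * Real.log (4 * (1 - q) / (β - q)))
  | .berserk => 2 * Real.exp (-(1 / 8) * n * ((β - q) ^ 2 / (4 * (1 - q))))
      + (q + Real.sqrt (2 * (k : ℝ)⁻¹ * Real.log (4 * (1 - q) / (β - q)))) / (1 - 2 * β)

/-- The security estimate `1 - W - ψ^{m₀}` is available (`φ > 0`) and can be made arbitrarily close
to `1` for all large `n` by a choice of the parameters. -/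
def EstimateWorks (kind : AdversaryKind) (q β : ℝ) : Prop :=
  ∀ ε : ℝ, 0 < ε → ∃ m₀ ℓ u : ℕ, ∃ k : ℕ → ℕ, 1 ≤ m₀ ∧ 1 ≤ ℓ ∧ 1 ≤ u ∧
    Tendsto k atTop atTop ∧ Tendsto (fun n => (k n : ℝ) / n) atTop (𝓝 0) ∧
    ∀ᶠ n : ℕ in atTop, 0 < phi β q (k n) ∧
      1 - ε ≤ 1 - bigW β q n (k n) m₀ ℓ u - psi β q n (k n) kind ^ m₀

end RandomThreshold

namespace RandomThreshold

open ProbabilityTheory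

/-! ### Resampling one coordinate of an infinite product -/

section Resampling

variable {X : Type*} [MeasurableSpace X] (μ : Measure X) [IsProbabilityMeasure μ]

/-! The positive statements about the protocol are proved with `ℓ = u = 1` and `k = √n`. Every
opinion is then final after round `m₀ + 1`, so only agreement at that moment matters
(`consensusProb_one_one`). By Hoeffding and a union bound, all honest nodes sample any fixed
assignment of opinions up to an error `δ` in every round considered, except on an event of
probability of order `n exp(-2δ²√n)`. A cautious adversary shows all nodes the same proportion of
ones. The nodes can disagree after round 2 only if the fresh threshold, uniform on an interval of
length `1 - 2β`, falls within `δ` of this proportion. Hence `m₀ = 1` suffices. A berserk adversary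
widens the critical window from `2δ` to `q + 2δ`. If `q < 1 - 2β`, a round fails to unite the nodes
with conditional probability bounded by a constant below 1, so `m₀` rounds give geometric decay
(`law_real_undecided_le`). If moreover `q + δ < β`, an agreement once reached persists, as the
thresholds stay in `[β, 1 - β]`. Conversely, let `q ≥ 1 - 2β`. The adversary suggests 1 to one half
of the honest nodes and 0 to the other half. While these obey, the two halves see proportions near
`(1 - q)/2 ≤ β` and `(1 + q)/2 ≥ 1 - β`, so almost every threshold confirms the division. Suitable
initial opinions make the first round start this with positive probability. Here `k` may grow
arbitrarily slowly and a union bound over nodes is not available; Markov's inequality bounds the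
number of misled nodes instead (`law_real_agreement_splitStrategy_le`). For the security estimate,
`W → 0` with `k = √n`, `ℓ = 2`, `u = 1`, and `ψ` tends to 0 (cautious) or `q/(1 - 2β)` (berserk), so
a large `m₀` suffices when the limit is below 1. Positivity of `φ` forces `q < β`, and `ψ_ber ≥ q/(1
- 2β)` gives the other necessary condition. The value 1/3 is where `q < β` and `q < 1 - 2β` cease to
be compatible. Conditioning on the past is expressed by resampling: replacing one coordinate by an
independent copy preserves an infinite product law. -/

theorem map_update_infinitePi (t : ℕ) :
    ((Measure.infinitePi fun _ : ℕ => μ).prod μ).map (fun p => Function.update p.1 t p.2)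
      = Measure.infinitePi fun _ : ℕ => μ := by
  refine Measure.eq_infinitePi _ fun s B hB => ?_
  have hm : Measurable fun p : (ℕ → X) × X => Function.update p.1 t p.2 := measurable_update'
  rw [Measure.map_apply hm (MeasurableSet.pi s.countable_toSet fun i _ => hB i)]
  by_cases ht : t ∈ s
  · have : (fun p : (ℕ → X) × X => Function.update p.1 t p.2) ⁻¹' (Set.pi s B)
        = (Set.pi (s.erase t : Finset ℕ) B) ×ˢ (B t) := by
      ext p
      simp only [Set.mem_preimage, Set.mem_pi, Set.mem_prod, Finset.mem_coe, Finset.mem_erase]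
      constructor
      · intro h
        refine ⟨fun i hi => ?_, by simpa using h t ht⟩
        simpa [Function.update_of_ne hi.1] using h i hi.2
      · rintro ⟨h1, h2⟩ i hi
        rcases eq_or_ne i t with rfl | hne
        · simpa using h2
        · simpa [Function.update_of_ne hne] using h1 i ⟨hne, hi⟩
    rw [this, Measure.prod_prod, Measure.infinitePi_pi _ fun i _ => hB i,
      Finset.prod_erase_mul _ _ ht]
  · have : (fun p : (ℕ → X) × X => Function.update p.1 t p.2) ⁻¹' (Set.pi s B)
        = (Set.pi s B) ×ˢ Set.univ := by
      ext p
      simp only [Set.mem_preimage, Set.mem_pi, Set.mem_prod, Set.mem_univ, and_true]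
      refine forall₂_congr fun i hi => ?_
      rw [Function.update_of_ne (ne_of_mem_of_not_mem hi ht)]
    rw [this, Measure.prod_prod, Measure.infinitePi_pi _ fun i _ => hB i, measure_univ, mul_one]

/-- If an event has probability at most `c` when coordinate `t` is resampled, whatever the other
coordinates are, within an event `F` that does not depend on coordinate `t`, then its probability
within `F` is at most `c` times that of `F`. -/
theorem infinitePi_real_inter_le (t : ℕ) {E F : Set (ℕ → X)} (hE : MeasurableSet E)
    (hF : MeasurableSet F) (hinv : ∀ ω x, Function.update ω t x ∈ F ↔ ω ∈ F) {c : ℝ} (hc : 0 ≤ c)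
    (h : ∀ ω ∈ F, μ.real {x | Function.update ω t x ∈ E} ≤ c) :
    (Measure.infinitePi fun _ : ℕ => μ).real (F ∩ E)
      ≤ c * (Measure.infinitePi fun _ : ℕ => μ).real F := by
  have hm : Measurable fun p : (ℕ → X) × X => Function.update p.1 t p.2 := measurable_update'
  have key : (Measure.infinitePi fun _ : ℕ => μ) (F ∩ E)
      ≤ ENNReal.ofReal c * (Measure.infinitePi fun _ : ℕ => μ) F := by
    -- Only the left side is resampled. After Fubini, invariance of `F` makes the inner measure
    -- vanish for `ω` outside `F`, and the hypothesis bounds it by `c` inside.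
    conv_lhs => rw [← map_update_infinitePi μ t]
    rw [Measure.map_apply hm (hF.inter hE), Measure.prod_apply (hm (hF.inter hE)),
      ← lintegral_indicator_const hF]
    refine lintegral_mono fun ω => ?_
    by_cases hω : ω ∈ F
    · rw [Set.indicator_of_mem hω]
      refine le_trans (measure_mono (t := {x | Function.update ω t x ∈ E}) fun x hx => hx.2) ?_
      rw [← ENNReal.ofReal_toReal (measure_ne_top μ {x | Function.update ω t x ∈ E})]
      exact ENNReal.ofReal_le_ofReal (h ω hω)
    · rw [Set.indicator_of_notMem hω, nonpos_iff_eq_zero]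
      convert measure_empty (μ := μ)
      ext x
      simp only [Set.mem_preimage, Set.mem_inter_iff, Set.mem_empty_iff_false, iff_false, not_and]
      exact fun h' => absurd ((hinv ω x).1 h') hω
  have := ENNReal.toReal_mono (by finiteness) key
  rwa [ENNReal.toReal_mul, ENNReal.toReal_ofReal hc] at this

theorem infinitePi_real_le (t : ℕ) {E : Set (ℕ → X)} (hE : MeasurableSet E) {c : ℝ} (hc : 0 ≤ c)
    (h : ∀ ω, μ.real {x | Function.update ω t x ∈ E} ≤ c) :
    (Measure.infinitePi fun _ : ℕ => μ).real E ≤ c := by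
  simpa using infinitePi_real_inter_le μ t hE MeasurableSet.univ (by simp) hc fun ω _ => h ω

end Resampling

/-! ### Products of two probability measures -/

section Product

variable {α β : Type*} [MeasurableSpace α] [MeasurableSpace β] (μ : Measure α) (ν : Measure β)
  [IsProbabilityMeasure μ] [IsProbabilityMeasure ν]

theorem prod_real_le_of_right {E : Set (α × β)} (hE : MeasurableSet E) {c : ℝ}
    (h : ∀ a, ν.real {b | (a, b) ∈ E} ≤ c) : (μ.prod ν).real E ≤ c := by
  have hc : 0 ≤ c := by
    obtain ⟨a⟩ : Nonempty α := nonempty_of_isProbabilityMeasure μ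
    exact measureReal_nonneg.trans (h a)
  refine ENNReal.toReal_le_of_le_ofReal hc ?_
  rw [Measure.prod_apply hE]
  calc ∫⁻ a, ν (Prod.mk a ⁻¹' E) ∂μ ≤ ∫⁻ _, ENNReal.ofReal c ∂μ := by
        refine lintegral_mono fun a => ?_
        rw [← ENNReal.ofReal_toReal (measure_ne_top ν (Prod.mk a ⁻¹' E))]
        exact ENNReal.ofReal_le_ofReal (h a)
    _ = ENNReal.ofReal c := by simp

theorem prod_real_le_of_left {E : Set (α × β)} (hE : MeasurableSet E) {c : ℝ}
    (h : ∀ b, μ.real {a | (a, b) ∈ E} ≤ c) : (μ.prod ν).real E ≤ c := by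
  have hs : MeasurableSet (Prod.swap ⁻¹' E) := measurable_swap hE
  have := prod_real_le_of_right ν μ hs h
  rwa [← Measure.prod_swap, measureReal_def, Measure.map_apply measurable_swap hE,
    ← measureReal_def]

/-- The Markov inequality for the number of events that occur. -/
theorem markov_card_le {ι : Type*} [Fintype ι] (P : ι → α → Prop) (hP : ∀ i, MeasurableSet {x | P i x})
    {ρ r : ℝ} (hr : 0 < r) (h : ∀ i, μ.real {x | P i x} ≤ ρ) :
    μ.real {x | r ≤ ({i | P i x} : Set ι).ncard} ≤ Fintype.card ι * ρ / r := by
  classical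
  have hsum : ∀ x, (({i | P i x} : Set ι).ncard : ℝ)
      = ∑ i, Set.indicator {x | P i x} (fun _ => (1 : ℝ)) x := by
    intro x
    rw [Set.ncard_eq_toFinset_card']
    simp [Set.indicator_apply, Finset.sum_boole]
  have hint : ∀ i, Integrable (Set.indicator {x | P i x} (fun _ => (1 : ℝ))) μ := fun i =>
    (integrable_const 1).indicator (hP i)
  have h1 := mul_meas_ge_le_integral_of_nonneg (μ := μ)
    (f := fun x => (({i | P i x} : Set ι).ncard : ℝ)) (Eventually.of_forall fun x => by positivity)
    (by simp_rw [hsum]; exact integrable_finsetSum _ fun i _ => hint i) r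
  have h2 : ∫ x, (({i | P i x} : Set ι).ncard : ℝ) ∂μ ≤ Fintype.card ι * ρ := by
    simp_rw [hsum]
    rw [integral_finsetSum _ fun i _ => hint i]
    calc _ = ∑ i, μ.real {x | P i x} := by
          refine Finset.sum_congr rfl fun i _ => ?_
          rw [integral_indicator_const _ (hP i)]; simp
      _ ≤ ∑ _ : ι, ρ := Finset.sum_le_sum fun i _ => h i
      _ = _ := by simp
  rw [le_div_iff₀ hr, mul_comm]
  exact h1.trans h2

end Product

/-! ### Concentration of the number of hits among independent uniform queries -/

section Concentration

variable {N : Type*} [Fintype N]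

/-- The proportion of the elements with property `v`. -/
noncomputable def density (v : N → Bool) : ℝ :=
  (Finset.univ.filter fun z => v z = true).card / Fintype.card N

variable [MeasurableSpace N] [DiscreteMeasurableSpace N]

theorem integral_uniformOn_indicator (v : N → Bool) :
    ∫ z, (if v z = true then (1 : ℝ) else 0) ∂(uniformOn (Set.univ : Set N)) = density v := by
  classical
  have h : (fun z => if v z = true then (1 : ℝ) else 0)
      = Set.indicator {z | v z = true} fun _ => (1 : ℝ) := by
    ext z; simp [Set.indicator_apply]
  rw [h, integral_indicator_const _ (MeasurableSet.of_discrete), measureReal_def, uniformOn_univ,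
    Measure.count_apply MeasurableSet.of_discrete]
  simp [density, Set.encard_eq_coe_toFinset_card, ENNReal.toReal_div]

/-- The Hoeffding inequality. -/
theorem hoeffding_uniformOn [Nonempty N] (k : ℕ) (v : N → Bool) {δ : ℝ} (hδ : 0 ≤ δ) :
    (Measure.pi fun _ : Fin k => uniformOn (Set.univ : Set N)).real
      {Q | δ * k ≤ |((Finset.univ.filter fun i => v (Q i) = true).card : ℝ) - k * density v|}
      ≤ 2 * Real.exp (-2 * k * δ ^ 2) := by
  set μ := Measure.pi fun _ : Fin k => uniformOn (Set.univ : Set N) with hμ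
  set Y : N → ℝ := fun z => (if v z = true then (1 : ℝ) else 0) - density v with hY
  -- Values in `[0,1]` give the variance proxy `((1 - 0)/2)² = 1/4`.
  have hsub0 : HasSubgaussianMGF Y (1 / 4) (uniformOn (Set.univ : Set N)) := by
    have := hasSubgaussianMGF_of_mem_Icc (μ := uniformOn (Set.univ : Set N)) (a := 0) (b := 1)
      (X := fun z => if v z = true then (1 : ℝ) else 0) (Measurable.of_discrete.aemeasurable)
      (Eventually.of_forall fun z => by split_ifs <;> simp)
    rw [integral_uniformOn_indicator] at this
    convert this using 1
    ext; simp; norm_num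
  have hsub : ∀ i : Fin k, HasSubgaussianMGF (fun Q : Fin k → N => Y (Q i)) (1 / 4) μ := by
    intro i
    have hp := measurePreserving_eval (fun _ : Fin k => uniformOn (Set.univ : Set N)) i
    refine HasSubgaussianMGF.of_map (Y := Function.eval i) (X := Y) hp.measurable.aemeasurable ?_
    rw [hp.map_eq]; exact hsub0
  have hind : iIndepFun (fun (i : Fin k) (Q : Fin k → N) => Y (Q i)) μ :=
    iIndepFun_pi (X := fun _ => Y) fun _ => Measurable.of_discrete.aemeasurable
  have hindn : iIndepFun (fun (i : Fin k) (Q : Fin k → N) => -Y (Q i)) μ :=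
    iIndepFun_pi (X := fun _ z => -Y z) fun _ => Measurable.of_discrete.aemeasurable
  have hsum : ∀ Q : Fin k → N, ((Finset.univ.filter fun i => v (Q i) = true).card : ℝ)
      - k * density v = ∑ i, Y (Q i) := by
    intro Q
    simp [hY, Finset.sum_boole]
  have hδk : 0 ≤ δ * k := by positivity
  have e : Real.exp (-(δ * k) ^ 2 / (2 * ((∑ _ : Fin k, (1 / 4 : NNReal) : NNReal) : ℝ)))
      = Real.exp (-2 * k * δ ^ 2) := by
    congr 1
    -- For `k = 0` the left exponent is `0 / 0 = 0`, which agrees with the right one.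
    rcases Nat.eq_zero_or_pos k with rfl | hk
    · simp
    · have : (k : ℝ) ≠ 0 := by positivity
      simp
      field_simp
      norm_num
  have h1 := HasSubgaussianMGF.measure_sum_ge_le_of_iIndepFun hind (s := Finset.univ)
    (fun i _ => hsub i) hδk
  have h2 := HasSubgaussianMGF.measure_sum_ge_le_of_iIndepFun hindn (s := Finset.univ)
    (fun i _ => (hsub i).neg) hδk
  rw [e] at h1 h2
  calc _ ≤ μ.real ({Q | δ * k ≤ ∑ i, Y (Q i)} ∪ {Q | δ * k ≤ ∑ i, -Y (Q i)}) := by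
        refine measureReal_mono fun Q hQ => ?_
        simp only [Set.mem_ofPred_eq, hsum, Set.mem_union, Finset.sum_neg_distrib] at hQ ⊢
        exact le_abs.1 hQ
    _ ≤ _ := measureReal_union_le _ _
    _ ≤ _ := by linarith

end Concentration

/-! ### Measurability -/

instance (h f : ℕ) : DiscreteMeasurableSpace (Node h f) where
  forall_measurableSet _ :=
    measurableSet_sum_iff.2 ⟨MeasurableSet.of_discrete, MeasurableSet.of_discrete⟩

instance (h f : ℕ) [NeZero h] : Nonempty (Node h f) := ⟨Sum.inl 0⟩

instance (h f k : ℕ) [NeZero h] : IsProbabilityMeasure (roundLaw h f k) := by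
  unfold roundLaw; infer_instance

instance (h f k : ℕ) [NeZero h] : IsProbabilityMeasure (law h f k) := by
  unfold law; infer_instance

instance : MeasurableSpace NodeState := ⊤

instance : DiscreteMeasurableSpace NodeState := ⟨fun _ => trivial⟩

instance : Countable NodeState :=
  Function.Injective.countable (f := fun s : NodeState => (s.opinion, s.run)) fun s t hst => by
    cases s; cases t; simpa using hst

section State

variable {h f k : ℕ} (a b β : ℝ) (m₀ ℓ : ℕ) (init : Fin h → Bool) (S : Strategy h f k)

/-- The answers of the Byzantine nodes at time `t`. -/
def answers (ω : ℕ → RoundNoise h f k) (t : ℕ) : Fin h → Fin k → Fin f → Bool :=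
  S.answer t (fun r : Fin t => ω r) (ω t).1.2 (ω t).2

/-- The opinions of the honest nodes after `t` rounds. -/
noncomputable def opinions (ω : ℕ → RoundNoise h f k) (t : ℕ) (j : Fin h) : Bool :=
  (state a b β m₀ ℓ init S ω t j).opinion

theorem measurable_answers (t : ℕ) : Measurable fun ω => answers S ω t :=
  (S.measurable_answer t).comp (f := fun ω : ℕ → RoundNoise h f k =>
    ((fun r : Fin t => ω r), (ω t).1.2, (ω t).2)) (by fun_prop)

theorem measurable_threshold (t : ℕ) : Measurable (threshold a b β t) := by
  unfold threshold
  split_ifs <;> fun_prop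

theorem measurable_state (t : ℕ) : Measurable fun ω => state a b β m₀ ℓ init S ω t := by
  classical
  induction t with
  | zero => exact measurable_const
  | succ t ih =>
    refine measurable_pi_lambda _ fun j => ?_
    -- States, answers and queries live in countable discrete spaces, where every function is
    -- measurable. Only the comparison with the real threshold needs an argument.
    have hD : Measurable fun ω : ℕ → RoundNoise h f k =>
        (state a b β m₀ ℓ init S ω t, answers S ω t, (ω t).2) :=
      ih.prodMk ((measurable_answers S t).prodMk (by fun_prop))
    let g : (Fin h → NodeState) × (Fin h → Fin k → Fin f → Bool) × Queries h f k → ℝ :=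
      fun D => (onesCount (fun i => (D.1 i).opinion) D.2.1 D.2.2 j : ℝ) / k
    have hg : Measurable g := Measurable.of_discrete
    have hB : Measurable fun ω : ℕ → RoundNoise h f k => decide (threshold a b β t (ω t).1.1
        ≤ g (state a b β m₀ ℓ init S ω t, answers S ω t, (ω t).2)) := by
      refine measurable_to_bool ?_
      have : MeasurableSet {ω : ℕ → RoundNoise h f k | threshold a b β t (ω t).1.1
          ≤ g (state a b β m₀ ℓ init S ω t, answers S ω t, (ω t).2)} :=
        measurableSet_le ((measurable_threshold a b β t).comp (by fun_prop)) (hg.comp hD)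
      convert this using 1
      ext ω; simp
    let G : (Fin h → NodeState) × Bool → NodeState := fun D =>
      let new : Bool := if ℓ ≤ (D.1 j).run then (D.1 j).opinion else D.2
      ⟨new, if t + 1 ≤ m₀ then 0 else if new = (D.1 j).opinion then (D.1 j).run + 1 else 1⟩
    have hG : Measurable G := Measurable.of_discrete
    convert hG.comp (ih.prodMk hB) using 1
    ext ω
    simp only [state, G, g, answers, Function.comp_apply]
    congr!

theorem measurable_opinions (t : ℕ) : Measurable fun ω => opinions a b β m₀ ℓ init S ω t :=
  (Measurable.of_discrete (f := fun (s : Fin h → NodeState) j => (s j).opinion)).comp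
    (measurable_state a b β m₀ ℓ init S t)

theorem state_congr {ω ω' : ℕ → RoundNoise h f k} (t : ℕ) (hω : ∀ r < t, ω r = ω' r) :
    state a b β m₀ ℓ init S ω t = state a b β m₀ ℓ init S ω' t := by
  induction t with
  | zero => rfl
  | succ t ih =>
    have h1 := ih fun r hr => hω r (hr.trans (Nat.lt_succ_self t))
    have h2 : (fun r : Fin t => ω r) = fun r : Fin t => ω' r :=
      funext fun r => hω r (r.2.trans (Nat.lt_succ_self t))
    simp only [state, h1, h2, hω t (Nat.lt_succ_self t)]

theorem opinions_update (ω : ℕ → RoundNoise h f k) {s t : ℕ} (hst : s ≤ t) (x : RoundNoise h f k) :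
    opinions a b β m₀ ℓ init S (Function.update ω t x) s = opinions a b β m₀ ℓ init S ω s := by
  ext j
  rw [opinions, opinions, state_congr a b β m₀ ℓ init S s (ω' := ω) fun r hr =>
    Function.update_of_ne (hr.trans_le hst).ne _ _]

end State

/-! ### The randomness of one round -/

section Round

variable {h f k : ℕ}

/-- The number of queries of honest node `j` that go to nodes with property `v`. -/
def hits (v : Node h f → Bool) (Q : Queries h f k) (j : Fin h) : ℕ :=
  (Finset.univ.filter fun i => v (Q j i) = true).card

/-- The proportion of the queries of honest node `j` that go to nodes with property `v` differs by at
least `δ` from its expectation. -/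
def Deviates (δ : ℝ) (v : Node h f → Bool) (Q : Queries h f k) (j : Fin h) : Prop :=
  δ * k ≤ |(hits v Q j : ℝ) - k * density v|

/-- A random object that is known, when the private randomness of the adversary at time `t` and
everything else but the queries and the common random number of that time are given. -/
def DeterminedBefore {γ : Type*} (t : ℕ) (v : (ℕ → RoundNoise h f k) → γ) : Prop :=
  ∀ ω x x', x.1.2 = x'.1.2 → v (Function.update ω t x) = v (Function.update ω t x')

/-- Once the adversary's private number is fixed, `v` is frozen while the queries are still fresh,
so Hoeffding applies to each node and Markov to their number. With `r = 1` this is the union bound;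
with `r` proportional to `h` the factor `h` cancels and any `k → ∞` makes the bound small. -/
theorem law_real_deviates_le [NeZero h] (t : ℕ) {v : (ℕ → RoundNoise h f k) → Node h f → Bool}
    (hv : Measurable v) (hvt : DeterminedBefore t v) {δ r : ℝ} (hδ : 0 ≤ δ) (hr : 0 < r) :
    (law h f k).real {ω | r ≤ ({j | Deviates δ (v ω) (ω t).2 j} : Set (Fin h)).ncard}
      ≤ h * (2 * Real.exp (-2 * k * δ ^ 2)) / r := by
  have hc : 0 ≤ h * (2 * Real.exp (-2 * k * δ ^ 2)) / r := by positivity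
  have hvQ : Measurable fun ω : ℕ → RoundNoise h f k => (v ω, (ω t).2) :=
    hv.prodMk (by fun_prop)
  have hE : MeasurableSet {ω : ℕ → RoundNoise h f k |
      r ≤ ({j | Deviates δ (v ω) (ω t).2 j} : Set (Fin h)).ncard} :=
    hvQ (t := {p | r ≤ ({j | Deviates δ p.1 p.2 j} : Set (Fin h)).ncard})
      MeasurableSet.of_discrete
  refine infinitePi_real_le (roundLaw h f k) t hE hc fun ω => ?_
  refine prod_real_le_of_right _ _ ((measurable_update ω) hE) fun y => ?_
  obtain ⟨Q₀⟩ : Nonempty (Queries h f k) := inferInstance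
  have hv0 : ∀ Q, v (Function.update ω t (y, Q)) = v (Function.update ω t (y, Q₀)) :=
    fun Q => hvt ω _ _ rfl
  simp only [Set.mem_preimage, Set.mem_ofPred_eq, hv0, Function.update_self]
  set v₀ := v (Function.update ω t (y, Q₀))
  have := markov_card_le (Measure.pi fun _ : Fin h => Measure.pi fun _ : Fin k =>
      uniformOn (Set.univ : Set (Node h f))) (fun j Q => Deviates δ v₀ Q j)
    (fun _ => MeasurableSet.of_discrete) hr (ρ := 2 * Real.exp (-2 * k * δ ^ 2)) fun j => ?_
  · simpa using this
  · have hp := measurePreserving_eval (fun _ : Fin h => Measure.pi fun _ : Fin k =>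
      uniformOn (Set.univ : Set (Node h f))) j
    have := hoeffding_uniformOn k v₀ hδ
    rwa [← hp.map_eq, measureReal_def, Measure.map_apply hp.measurable MeasurableSet.of_discrete]
      at this

theorem volume_real_affine_mem_Icc_le {c d lo hi : ℝ} (hd : 0 < d) (hlh : lo ≤ hi) :
    (volume : Measure unitInterval).real {x | c + d * (x : ℝ) ∈ Set.Icc lo hi} ≤ (hi - lo) / d := by
  rw [measureReal_def, unitInterval.volume_apply]
  refine ENNReal.toReal_le_of_le_ofReal (by have := sub_nonneg.2 hlh; positivity) ?_
  calc _ ≤ volume (Set.Icc ((lo - c) / d) ((hi - c) / d)) := by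
        refine measure_mono ?_
        rintro _ ⟨x, hx, rfl⟩
        rw [Set.mem_ofPred_eq, Set.mem_Icc] at hx
        rw [Set.mem_Icc, div_le_iff₀ hd, le_div_iff₀ hd]
        constructor <;> linarith
    _ = _ := by rw [Real.volume_Icc]; congr 1; ring

/-- The end points do not react to the common random number of time `t`, so resampling it gives a
uniform number against a fixed interval. The event `F` carries the past, which lets such bounds be
multiplied over rounds. -/
theorem law_real_threshold_mem_Icc_le [NeZero h] {a b β : ℝ} (hβ : β < 1 / 2) {t : ℕ} (ht : t ≠ 0)
    {lo hi : (ℕ → RoundNoise h f k) → ℝ} (hlo : Measurable lo) (hhi : Measurable hi)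
    (hlot : DeterminedBefore t lo) (hhit : DeterminedBefore t hi) {L : ℝ}
    (hlh : ∀ ω, lo ω ≤ hi ω) (hL : ∀ ω, hi ω - lo ω ≤ L) {F : Set (ℕ → RoundNoise h f k)}
    (hF : MeasurableSet F) (hinv : ∀ ω x, Function.update ω t x ∈ F ↔ ω ∈ F) :
    (law h f k).real (F ∩ {ω | threshold a b β t (ω t).1.1 ∈ Set.Icc (lo ω) (hi ω)})
      ≤ L / (1 - 2 * β) * (law h f k).real F := by
  have hd : 0 < 1 - 2 * β := by linarith
  obtain ⟨x₀⟩ : Nonempty (RoundNoise h f k) := inferInstance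
  have hL0 : 0 ≤ L := (sub_nonneg.2 (hlh fun _ => x₀)).trans (hL _)
  have hthr : Measurable fun ω : ℕ → RoundNoise h f k => threshold a b β t (ω t).1.1 :=
    (measurable_threshold a b β t).comp (by fun_prop)
  have hE : MeasurableSet {ω : ℕ → RoundNoise h f k |
      threshold a b β t (ω t).1.1 ∈ Set.Icc (lo ω) (hi ω)} :=
    (measurableSet_le hlo hthr).inter (measurableSet_le hthr hhi)
  refine infinitePi_real_inter_le (roundLaw h f k) t hE hF hinv (by positivity) fun ω _ => ?_
  refine prod_real_le_of_left _ _ ((measurable_update ω) hE) fun Q => ?_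
  refine prod_real_le_of_left _ _ (((measurable_update ω).comp measurable_prodMk_right) hE)
    fun s => ?_
  have h1 : ∀ x, lo (Function.update ω t ((x, s), Q)) = lo (Function.update ω t ((0, s), Q)) :=
    fun x => hlot ω _ _ rfl
  have h2 : ∀ x, hi (Function.update ω t ((x, s), Q)) = hi (Function.update ω t ((0, s), Q)) :=
    fun x => hhit ω _ _ rfl
  simp only [Set.mem_preimage, Function.comp_apply, Set.mem_ofPred_eq, h1, h2, Function.update_self, threshold, if_neg ht]
  refine (volume_real_affine_mem_Icc_le hd (hlh _)).trans ?_
  gcongr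
  exact hL _

end Round

/-! ### One round of the protocol -/

section Step

variable {h f k : ℕ} (a b β : ℝ) (m₀ ℓ : ℕ) (init : Fin h → Bool) (S : Strategy h f k)
  (ω : ℕ → RoundNoise h f k)

/-- The number of `1`-answers that honest node `j` gets at time `t`. -/
noncomputable def ones (t : ℕ) (j : Fin h) : ℕ :=
  onesCount (opinions a b β m₀ ℓ init S ω t) (answers S ω t) (ω t).2 j

variable {ℓ} in
theorem opinions_succ {t : ℕ} {j : Fin h} (hℓ : (state a b β m₀ ℓ init S ω t j).run < ℓ) :
    opinions a b β m₀ ℓ init S ω (t + 1) j = true ↔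
      threshold a b β t (ω t).1.1 ≤ (ones a b β m₀ ℓ init S ω t j : ℝ) / k := by
  simp only [opinions, state, if_neg hℓ.not_ge, decide_eq_true_eq]
  rfl

variable {m₀} in
theorem run_eq_zero {t : ℕ} (ht : t ≤ m₀) (j : Fin h) :
    (state a b β m₀ ℓ init S ω t j).run = 0 := by
  cases t with
  | zero => rfl
  | succ t => simp only [state, if_pos ht]

theorem one_le_run (j : Fin h) : 1 ≤ (state a b β m₀ ℓ init S ω (m₀ + 1) j).run := by
  simp only [state]
  rw [if_neg (by omega)]
  split_ifs <;> omega

/-- Together with `onesCount_le_hits`, this encloses any Byzantine behaviour between the two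
extremes where all Byzantine nodes answer 0 or all answer 1. -/
theorem hits_le_onesCount (op : Fin h → Bool) (ans : Fin h → Fin k → Fin f → Bool)
    (Q : Queries h f k) (j : Fin h) :
    hits (Sum.elim op fun _ => false) Q j ≤ onesCount op ans Q j := by
  refine Finset.card_le_card fun i => ?_
  simp only [Finset.mem_filter, Finset.mem_univ, true_and]
  cases Q j i <;> simp

theorem onesCount_le_hits (op : Fin h → Bool) (ans : Fin h → Fin k → Fin f → Bool)
    (Q : Queries h f k) (j : Fin h) :
    onesCount op ans Q j ≤ hits (Sum.elim op fun _ => true) Q j := by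
  refine Finset.card_le_card fun i => ?_
  simp only [Finset.mem_filter, Finset.mem_univ, true_and]
  cases Q j i <;> simp

theorem density_sum_elim (op : Fin h → Bool) (c : Bool) :
    density (N := Node h f) (Sum.elim op fun _ => c)
      = ((Finset.univ.filter fun j => op j = true).card + if c then (f : ℝ) else 0) / (h + f) := by
  unfold density
  congr 1
  · have e : (Finset.univ.filter fun z : Node h f => Sum.elim op (fun _ => c) z = true).card
        = (Finset.univ.filter fun j => op j = true).card + if c then f else 0 := by
      rw [Finset.card_filter, Fintype.sum_sum_type]
      cases c <;> simp [Finset.card_filter, -Finset.sum_boole] <;> rfl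
    rw [e]
    push_cast
    rfl
  · simp

/-- All honest nodes have the same opinion after `t` rounds. -/
def Agreement (t : ℕ) : Prop := ∃ c : Bool, ∀ j, opinions a b β m₀ ℓ init S ω t j = c

theorem measurableSet_agreement (t : ℕ) :
    MeasurableSet {ω | Agreement a b β m₀ ℓ init S ω t} :=
  (measurable_opinions a b β m₀ ℓ init S t) (t := {op | ∃ c : Bool, ∀ j, op j = c})
    MeasurableSet.of_discrete

variable {ℓ ω} in
/-- If the threshold is below the proportion of `1`-answers at all nodes, or above all of them, then
all nodes adopt the same opinion. -/
theorem agreement_succ {t : ℕ} (hk : 0 < k)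
    (hℓ : ∀ j, (state a b β m₀ ℓ init S ω t j).run < ℓ) {v w : Node h f → Bool} {δ : ℝ}
    (hv : ∀ j, ¬Deviates δ v (ω t).2 j) (hw : ∀ j, ¬Deviates δ w (ω t).2 j)
    (hvo : ∀ j, hits v (ω t).2 j ≤ ones a b β m₀ ℓ init S ω t j)
    (how : ∀ j, ones a b β m₀ ℓ init S ω t j ≤ hits w (ω t).2 j)
    (hX : threshold a b β t (ω t).1.1 ∉ Set.Icc (density v - δ) (density w + δ)) :
    Agreement a b β m₀ ℓ init S ω (t + 1) := by
  have hk' : (0 : ℝ) < k := by exact_mod_cast hk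
  rw [Set.mem_Icc, not_and_or, not_le, not_le] at hX
  rcases hX with hX | hX
  · refine ⟨true, fun j => (opinions_succ a b β m₀ init S ω (hℓ j)).2 ?_⟩
    have h1 := hv j
    rw [Deviates, not_le, abs_lt] at h1
    have h2 : (hits v (ω t).2 j : ℝ) ≤ ones a b β m₀ ℓ init S ω t j := by exact_mod_cast hvo j
    rw [le_div_iff₀ hk']
    nlinarith
  · refine ⟨false, fun j => ?_⟩
    rw [← Bool.not_eq_true, opinions_succ a b β m₀ init S ω (hℓ j), not_le]
    have h1 := hw j
    rw [Deviates, not_le, abs_lt] at h1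
    have h2 : (ones a b β m₀ ℓ init S ω t j : ℝ) ≤ hits w (ω t).2 j := by exact_mod_cast how j
    rw [div_lt_iff₀ hk']
    nlinarith

end Step

theorem threshold_mem_Icc {a b β : ℝ} (hβ : β < 1 / 2) {t : ℕ} (ht : t ≠ 0) (x : unitInterval) :
    threshold a b β t x ∈ Set.Icc β (1 - β) := by
  have h0 := x.2.1
  have h1 := x.2.2
  rw [threshold, if_neg ht]
  constructor <;> nlinarith

theorem one_le_ncard_of_exists {ι : Type*} [Finite ι] {P : ι → Prop} (hP : ∃ i, P i) :
    (1 : ℝ) ≤ ({i | P i} : Set ι).ncard := by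
  exact_mod_cast (Set.ncard_pos (Set.toFinite _)).2 hP

/-- `P(∃ j, ...)` is at most this for the deviations in one round. -/
noncomputable def deviationBound (h k : ℕ) (δ : ℝ) : ℝ := h * (2 * Real.exp (-2 * k * δ ^ 2))

theorem law_real_exists_deviates_le {h f k : ℕ} [NeZero h] (t : ℕ)
    {v : (ℕ → RoundNoise h f k) → Node h f → Bool}
    (hv : Measurable v) (hvt : DeterminedBefore t v) {δ : ℝ} (hδ : 0 ≤ δ) :
    (law h f k).real {ω | ∃ j, Deviates δ (v ω) (ω t).2 j} ≤ deviationBound h k δ := by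
  refine (measureReal_mono fun ω hω => ?_).trans
    ((law_real_deviates_le t hv hvt hδ one_pos).trans_eq (div_one _))
  exact one_le_ncard_of_exists hω

/-! ### Agreement against a cautious adversary -/

section Cautious

variable {h f k : ℕ} (a b β : ℝ) (init : Fin h → Bool) (S : Strategy h f k)

/-- Caution makes the Byzantine answers independent of the queries and of the asking node, so one
assignment `v`, known before the queries, describes what everybody samples. The decisive threshold
is that of time 1; the first one is not used, since `[a,b]` may be a single point. -/
theorem law_real_not_agreement_le_cautious [NeZero h] (hk : 0 < k) (hβ : β < 1 / 2)
    (hS : S.Allowed .cautious) {δ : ℝ} (hδ : 0 ≤ δ) :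
    (law h f k).real {ω | ¬Agreement a b β 1 1 init S ω 2}
      ≤ 2 * δ / (1 - 2 * β) + deviationBound h k δ := by
  let j₀ : Fin h := 0
  let i₀ : Fin k := ⟨0, hk⟩
  let v : (ℕ → RoundNoise h f k) → Node h f → Bool := fun ω =>
    Sum.elim (opinions a b β 1 1 init S ω 1) (answers S ω 1 j₀ i₀)
  have hv : Measurable v :=
    (Measurable.of_discrete (f := fun p : (Fin h → Bool) × (Fin h → Fin k → Fin f → Bool) =>
      (Sum.elim p.1 (p.2 j₀ i₀) : Node h f → Bool))).comp
      ((measurable_opinions a b β 1 1 init S 1).prodMk (measurable_answers S 1))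
  have hvt : DeterminedBefore 1 v := by
    intro ω x x' hx
    simp only [v, opinions_update a b β 1 1 init S ω le_rfl]
    congr 1
    ext z
    simp only [answers, Function.update_self, hx]
    rw [hS 1 _ _ x.2 x'.2 j₀ j₀ i₀ i₀ z]
    congr 2
    ext r : 1
    rw [Function.update_of_ne r.2.ne, Function.update_of_ne r.2.ne]
  have hdm : Measurable fun ω => density (v ω) :=
    (Measurable.of_discrete (f := fun w : Node h f → Bool => density w)).comp hv
  have hthr := law_real_threshold_mem_Icc_le (a := a) (b := b) hβ one_ne_zero (h := h) (f := f)
    (k := k) (hdm.sub_const δ) (hdm.add_const δ)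
    (fun ω x x' hx => by simp only [hvt ω x x' hx]) (fun ω x x' hx => by simp only [hvt ω x x' hx])
    (L := 2 * δ) (fun ω => by linarith) (fun ω => by linarith) MeasurableSet.univ (by simp)
  rw [Set.univ_inter, probReal_univ, mul_one] at hthr
  refine (measureReal_mono (s₂ := _ ∪ _) fun ω hω => ?_).trans
    ((measureReal_union_le _ _).trans
      (add_le_add hthr (law_real_exists_deviates_le 1 hv hvt hδ)))
  by_contra hcon
  simp only [Set.mem_union, not_or, Set.mem_ofPred_eq, not_exists] at hcon hω
  have hones : ∀ j, ones a b β 1 1 init S ω 1 j = hits (v ω) (ω 1).2 j := by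
    intro j
    have : ∀ i, answers S ω 1 j i = answers S ω 1 j₀ i₀ := fun i => funext fun z =>
      hS 1 _ _ _ _ j j₀ i i₀ z
    simp only [ones, onesCount, this]
    rfl
  exact hω (agreement_succ a b β 1 init S hk
    (fun j => by rw [run_eq_zero a b β 1 init S ω le_rfl]; exact one_pos) hcon.2 hcon.2
    (fun j => (hones j).ge) (fun j => (hones j).le) hcon.1)

end Cautious

/-! ### Agreement against a berserk adversary -/

section Ballot

variable {h f k : ℕ} (a b β : ℝ) (m₀ ℓ : ℕ) (init : Fin h → Bool) (S : Strategy h f k)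

/-- The nodes that may answer `1`: those that certainly do, when `c` is false, and those that
possibly do, when `c` is true. -/
noncomputable def ballot (c : Bool) (t : ℕ) (ω : ℕ → RoundNoise h f k) : Node h f → Bool :=
  Sum.elim (opinions a b β m₀ ℓ init S ω t) fun _ => c

theorem measurable_ballot (c : Bool) (t : ℕ) : Measurable (ballot a b β m₀ ℓ init S c t) :=
  (Measurable.of_discrete (f := fun p : Fin h → Bool =>
    (Sum.elim p fun _ => c : Node h f → Bool))).comp (measurable_opinions a b β m₀ ℓ init S t)

theorem ballot_update (c : Bool) {s t : ℕ} (hst : s ≤ t) (ω : ℕ → RoundNoise h f k) (x) :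
    ballot a b β m₀ ℓ init S c s (Function.update ω t x) = ballot a b β m₀ ℓ init S c s ω := by
  simp only [ballot, opinions_update a b β m₀ ℓ init S ω hst]

theorem determinedBefore_ballot (c : Bool) (t : ℕ) :
    DeterminedBefore t (ballot a b β m₀ ℓ init S c t) := fun ω x x' _ => by
  rw [ballot_update _ _ _ _ _ _ _ _ le_rfl, ballot_update _ _ _ _ _ _ _ _ le_rfl]

theorem measurable_density_ballot (c : Bool) (t : ℕ) :
    Measurable fun ω => density (ballot a b β m₀ ℓ init S c t ω) :=
  (Measurable.of_discrete (f := fun w : Node h f → Bool => density w)).comp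
    (measurable_ballot a b β m₀ ℓ init S c t)

theorem density_ballot_true (t : ℕ) (ω : ℕ → RoundNoise h f k) :
    density (ballot a b β m₀ ℓ init S true t ω)
      = density (ballot a b β m₀ ℓ init S false t ω) + (f : ℝ) / (h + f) := by
  simp only [ballot, density_sum_elim]
  simp [add_div]

end Ballot

/-! ### Geometric decay of indecision, and persistence of agreement -/

section Berserk

variable {h f k : ℕ} (a b β : ℝ) (m₀ : ℕ) (init : Fin h → Bool) (S : Strategy h f k)

/-- The event that the thresholds at times `1, …, s` are such that the adversary may prevent
agreement. -/
def undecided (δ : ℝ) (s : ℕ) : Set (ℕ → RoundNoise h f k) :=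
  {ω | ∀ r < s, threshold a b β (r + 1) (ω (r + 1)).1.1 ∈
    Set.Icc (density (ballot a b β m₀ 1 init S false (r + 1) ω) - δ)
      (density (ballot a b β m₀ 1 init S true (r + 1) ω) + δ)}

theorem undecided_succ (δ : ℝ) (s : ℕ) :
    undecided a b β m₀ init S δ (s + 1) = undecided a b β m₀ init S δ s ∩
      {ω | threshold a b β (s + 1) (ω (s + 1)).1.1 ∈
        Set.Icc (density (ballot a b β m₀ 1 init S false (s + 1) ω) - δ)
          (density (ballot a b β m₀ 1 init S true (s + 1) ω) + δ)} := by
  ext ω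
  exact Nat.forall_lt_succ_right

theorem measurableSet_undecided (δ : ℝ) (s : ℕ) :
    MeasurableSet (undecided a b β m₀ init S δ s) := by
  induction s with
  | zero => simp [undecided]
  | succ s ih =>
    rw [undecided_succ]
    have hthr : Measurable fun ω : ℕ → RoundNoise h f k =>
        threshold a b β (s + 1) (ω (s + 1)).1.1 :=
      (measurable_threshold a b β (s + 1)).comp (by fun_prop)
    exact ih.inter ((measurableSet_le
      ((measurable_density_ballot a b β m₀ 1 init S false _).sub_const δ) hthr).inter
      (measurableSet_le hthr ((measurable_density_ballot a b β m₀ 1 init S true _).add_const δ)))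

theorem law_real_undecided_le [NeZero h] (hβ : β < 1 / 2) {δ : ℝ} (hδ : 0 ≤ δ) (s : ℕ) :
    (law h f k).real (undecided a b β m₀ init S δ s)
      ≤ (((f : ℝ) / (h + f) + 2 * δ) / (1 - 2 * β)) ^ s := by
  have hd : 0 < 1 - 2 * β := by linarith
  induction s with
  | zero => simp [undecided]
  | succ s ih =>
    rw [undecided_succ]
    refine (law_real_threshold_mem_Icc_le hβ s.succ_ne_zero
      ((measurable_density_ballot a b β m₀ 1 init S false _).sub_const δ)
      ((measurable_density_ballot a b β m₀ 1 init S true _).add_const δ)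
      (fun ω x x' hx => by simp only [determinedBefore_ballot a b β m₀ 1 init S _ _ ω x x' hx])
      (fun ω x x' hx => by simp only [determinedBefore_ballot a b β m₀ 1 init S _ _ ω x x' hx])
      (L := (f : ℝ) / (h + f) + 2 * δ) (fun ω => ?_) (fun ω => ?_)
      (measurableSet_undecided a b β m₀ init S δ s) fun ω x => ?_).trans ?_
    · have : (0 : ℝ) ≤ (f : ℝ) / (h + f) := by positivity
      rw [density_ballot_true]; linarith
    · rw [density_ballot_true]; linarith
    -- Membership in the earlier event involves thresholds at times up to `s` and ballots determined
    -- by rounds before time `s`, so coordinate `s + 1` is free.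
    · refine forall₂_congr fun r hr => ?_
      rw [ballot_update _ _ _ _ _ _ _ _ (by omega), ballot_update _ _ _ _ _ _ _ _ (by omega),
        Function.update_of_ne (by omega)]
    · rw [pow_succ']
      gcongr

theorem agreement_of_not_undecided {ω : ℕ → RoundNoise h f k} (hk : 0 < k) (hh : 0 < h)
    (hβ : β < 1 / 2) {δ : ℝ} (hδβ : (f : ℝ) / (h + f) + δ < β)
    (hdev : ∀ c, ∀ r < m₀, ∀ j,
      ¬Deviates δ (ballot a b β m₀ 1 init S c (r + 1) ω) (ω (r + 1)).2 j) {s : ℕ} (hs : s ≤ m₀)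
    (hω : ω ∉ undecided a b β m₀ init S δ s) : Agreement a b β m₀ 1 init S ω (s + 1) := by
  have hh' : (0 : ℝ) < h := by exact_mod_cast hh
  induction s with
  | zero => simp [undecided] at hω
  | succ s ih =>
    refine agreement_succ a b β m₀ init S hk
      (fun j => by rw [run_eq_zero a b β 1 init S ω hs]; exact one_pos) (hdev false s hs)
      (hdev true s hs) (fun j => hits_le_onesCount _ _ _ j) (fun j => onesCount_le_hits _ _ _ j) ?_
    rw [undecided_succ, Set.mem_inter_iff, not_and_or] at hω
    rcases hω with hω | hω
    -- Agreement was reached earlier. Now the adversary shifts proportions by at most `f/(h + f)`,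
    -- and `f/(h + f) + δ < β` keeps them on the same side of every threshold in `[β, 1 - β]`.
    · have hX := threshold_mem_Icc (a := a) (b := b) hβ s.succ_ne_zero (ω (s + 1)).1.1
      have hsum : (f : ℝ) / (h + f) + (h : ℝ) / (h + f) = 1 := by field_simp; ring
      obtain ⟨c, hc⟩ := ih (by omega) hω
      rw [Set.mem_Icc, not_and_or, not_le, not_le]
      have hop : opinions a b β m₀ 1 init S ω (s + 1) = fun _ => c := funext hc
      cases c with
      | true =>
        left
        rw [ballot, density_sum_elim, hop]
        simp
        linarith [hX.2]
      | false =>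
        right
        rw [ballot, density_sum_elim, hop]
        simp
        linarith [hX.1]
    · exact hω

theorem law_real_not_agreement_le_berserk [NeZero h] (hk : 0 < k) (hβ : β < 1 / 2) {δ : ℝ}
    (hδ : 0 ≤ δ) (hδβ : (f : ℝ) / (h + f) + δ < β) :
    (law h f k).real {ω | ¬Agreement a b β m₀ 1 init S ω (m₀ + 1)}
      ≤ (((f : ℝ) / (h + f) + 2 * δ) / (1 - 2 * β)) ^ m₀ + 2 * m₀ * deviationBound h k δ := by
  have hsub : {ω | ¬Agreement a b β m₀ 1 init S ω (m₀ + 1)} ⊆ undecided a b β m₀ init S δ m₀ ∪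
      ⋃ p ∈ (Finset.univ : Finset (Bool × Fin m₀)),
        {ω | ∃ j, Deviates δ (ballot a b β m₀ 1 init S p.1 (p.2 + 1) ω) (ω (p.2 + 1)).2 j} := by
    intro ω hω
    by_contra hcon
    simp only [Set.mem_union, not_or, Set.mem_iUnion, Finset.mem_univ, exists_prop, true_and,
      not_exists, Set.mem_ofPred_eq] at hcon
    exact hω (agreement_of_not_undecided a b β m₀ init S hk (NeZero.pos h) hβ hδβ
      (fun c r hr j => hcon.2 (c, ⟨r, hr⟩) j) le_rfl hcon.1)
  refine (measureReal_mono hsub).trans ((measureReal_union_le _ _).trans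
    (add_le_add (law_real_undecided_le a b β m₀ init S hβ hδ m₀) ?_))
  refine (measureReal_biUnion_finset_le _ _).trans
    ((Finset.sum_le_sum fun p _ => law_real_exists_deviates_le _
      (measurable_ballot a b β m₀ 1 init S p.1 _) (determinedBefore_ballot a b β m₀ 1 init S p.1 _)
      hδ).trans_eq ?_)
  simp

end Berserk

/-! ### The number of queries -/

theorem tendsto_natSqrt_atTop : Tendsto Nat.sqrt atTop atTop :=
  tendsto_atTop_atTop_of_monotone (fun _ _ h => Nat.sqrt_le_sqrt h) fun b =>
    ⟨b * b, (Nat.sqrt_eq b).ge⟩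

theorem tendsto_natSqrt_div_self : Tendsto (fun n : ℕ => (Nat.sqrt n : ℝ) / n) atTop (𝓝 0) := by
  refine squeeze_zero (fun n => by positivity) (fun n => ?_)
    (tendsto_inv_atTop_nhds_zero_nat.comp tendsto_natSqrt_atTop)
  rcases Nat.eq_zero_or_pos n with rfl | hn
  · simp
  have h1 : (0 : ℝ) < n := by exact_mod_cast hn
  have h2 : (0 : ℝ) < Nat.sqrt n := by exact_mod_cast Nat.sqrt_pos.2 hn
  have h3 : (Nat.sqrt n : ℝ) * Nat.sqrt n ≤ n := by exact_mod_cast Nat.sqrt_le n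
  rw [Function.comp_apply, div_le_iff₀ h1, inv_mul_eq_div, le_div_iff₀ h2]
  exact h3

/-- With `m = ⌊√n⌋ + 1` one has `n ≤ m²`, and `m² exp(-c m) → 0`; the factor `exp c` undoes the
shift by one. -/
theorem tendsto_mul_exp_natSqrt {c : ℝ} (hc : 0 < c) :
    Tendsto (fun n : ℕ => (n : ℝ) * Real.exp (-c * Nat.sqrt n)) atTop (𝓝 0) := by
  have hr : |Real.exp (-c)| < 1 := by rw [abs_of_pos (Real.exp_pos _)]; simpa
  have h1 := ((tendsto_pow_const_mul_const_pow_of_abs_lt_one 2 hr).comp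
    ((tendsto_add_atTop_nat 1).comp tendsto_natSqrt_atTop)).mul_const (Real.exp c)
  rw [zero_mul] at h1
  refine squeeze_zero (fun n => by positivity) (fun n => ?_) h1
  have h2 : (n : ℝ) ≤ ((Nat.sqrt n + 1 : ℕ) : ℝ) ^ 2 := by
    exact_mod_cast (Nat.lt_succ_sqrt' n).le
  have h3 : Real.exp (-c) ^ (Nat.sqrt n + 1) * Real.exp c = Real.exp (-c * Nat.sqrt n) := by
    rw [← Real.exp_nat_mul, ← Real.exp_add]
    congr 1; push_cast; ring
  simp only [Function.comp_apply]
  rw [mul_assoc, h3]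
  gcongr

/-! ### The number of Byzantine nodes -/

theorem numByz_lt {q : ℝ} (hq : 0 ≤ q) (hq1 : q < 1) {n : ℕ} (hn : 0 < n) : numByz q n < n := by
  have hn' : (0 : ℝ) < n := by exact_mod_cast hn
  rw [numByz, Nat.floor_lt (by positivity)]
  nlinarith

theorem cast_honest {q : ℝ} (hq : 0 ≤ q) (hq1 : q < 1) (n : ℕ) :
    ((n - numByz q n : ℕ) : ℝ) = n - numByz q n := by
  rcases Nat.eq_zero_or_pos n with rfl | hn
  · simp [numByz]
  · exact Nat.cast_sub (numByz_lt hq hq1 hn).le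

theorem numByz_le {q : ℝ} (hq : 0 ≤ q) (n : ℕ) : (numByz q n : ℝ) ≤ q * n :=
  Nat.floor_le (by positivity)

/-! ### The protocol works -/

/-- After `m₀ + 1` rounds every opinion is final, if one round is enough for that. -/
theorem consensusProb_one_one {h f k : ℕ} [NeZero h] (a b β : ℝ) (m₀ : ℕ) (init : Fin h → Bool)
    (S : Strategy h f k) :
    consensusProb a b β m₀ 1 init S (m₀ + 1 * 1)
      = 1 - (law h f k).real {ω | ¬Agreement a b β m₀ 1 init S ω (m₀ + 1)} := by
  have h1 : {ω | ¬Agreement a b β m₀ 1 init S ω (m₀ + 1)}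
      = {ω | Agreement a b β m₀ 1 init S ω (m₀ + 1)}ᶜ := rfl
  rw [h1, probReal_compl_eq_one_sub (measurableSet_agreement a b β m₀ 1 init S _), sub_sub_cancel,
    consensusProb]
  congr 1
  ext ω
  refine exists_congr fun c => forall_congr' fun j => ?_
  rw [mul_one, and_iff_right (one_le_run a b β m₀ 1 init S ω j)]
  rfl

/-- It suffices to bound disagreement uniformly in `h`, `f`, `k`, with `m₀` and `δ` fixed: the
choice `k = √n` makes the remaining deviation term vanish. -/
theorem worksWhp_of_agreement {kind : AdversaryKind} {q β a b : ℝ} (hq : 0 ≤ q) (hq1 : q < 1)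
    (H : ∀ ε : ℝ, 0 < ε → ∃ m₀ : ℕ, ∃ δ C : ℝ, 1 ≤ m₀ ∧ 0 < δ ∧ 0 ≤ C ∧
      ∀ (h f k : ℕ) [NeZero h] (init : Fin h → Bool) (S : Strategy h f k), 0 < k →
        (f : ℝ) / (h + f) ≤ q → S.Allowed kind →
        (law h f k).real {ω | ¬Agreement a b β m₀ 1 init S ω (m₀ + 1)}
          ≤ ε + C * deviationBound h k δ) : WorksWhp kind q β a b := by
  intro ε hε
  obtain ⟨m₀, δ, C, hm, hδ, hC, H⟩ := H (ε / 2) (half_pos hε)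
  refine ⟨m₀, 1, 1, Nat.sqrt, hm, le_rfl, le_rfl, tendsto_natSqrt_atTop, tendsto_natSqrt_div_self,
    ?_⟩
  have hlim := (tendsto_mul_exp_natSqrt (c := 2 * δ ^ 2) (by positivity)).const_mul (C * 2)
  rw [mul_zero] at hlim
  filter_upwards [hlim.eventually (gt_mem_nhds (half_pos hε)), eventually_gt_atTop 0]
    with n hn hn0 init S hS
  have hlt := numByz_lt hq hq1 hn0
  have : NeZero (n - numByz q n) := ⟨by omega⟩
  have hn' : (0 : ℝ) < n := by exact_mod_cast hn0
  have h1 := H _ _ _ init S (Nat.sqrt_pos.2 hn0) (by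
    rw [cast_honest hq hq1, sub_add_cancel, div_le_iff₀ hn']
    exact numByz_le hq n) hS
  have h2 : C * deviationBound (n - numByz q n) (Nat.sqrt n) δ ≤ ε / 2 := by
    refine le_trans ?_ hn.le
    have h3 : ((n - numByz q n : ℕ) : ℝ) ≤ n := by exact_mod_cast Nat.sub_le _ _
    calc _ ≤ C * (n * (2 * Real.exp (-2 * Nat.sqrt n * δ ^ 2))) := by
          unfold deviationBound; gcongr
      _ = _ := by
          rw [show -2 * (Nat.sqrt n : ℝ) * δ ^ 2 = -(2 * δ ^ 2) * Nat.sqrt n by ring]; ring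
  rw [consensusProb_one_one]
  linarith

theorem worksWhp_cautious {q β a b : ℝ} (hq : 0 ≤ q) (hq1 : q < 1) (hβ : β < 1 / 2) :
    WorksWhp .cautious q β a b := by
  have hd : 0 < 1 - 2 * β := by linarith
  refine worksWhp_of_agreement hq hq1 fun ε hε => ⟨1, ε * (1 - 2 * β) / 2, 1, le_rfl,
    by positivity, zero_le_one, fun h f k _ init S hk _ hS => ?_⟩
  refine (law_real_not_agreement_le_cautious a b β init S hk hβ hS
    (δ := ε * (1 - 2 * β) / 2) (by positivity)).trans_eq ?_
  congr 1
  · field_simp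
  · rw [one_mul]

theorem worksWhp_berserk {q β a b : ℝ} (hq : 0 ≤ q) (hqβ : q < β) (hβ : β < 1 / 2)
    (hqβ' : q < 1 - 2 * β) : WorksWhp .berserk q β a b := by
  have hd : 0 < 1 - 2 * β := by linarith
  -- The first inequality preserves an agreement, the second makes the critical window shorter than
  -- the range of the threshold.
  obtain ⟨δ, hδ, hδ1, hδ2⟩ : ∃ δ : ℝ, 0 < δ ∧ q + δ < β ∧ q + 2 * δ < 1 - 2 * β := by
    refine ⟨min ((β - q) / 2) ((1 - 2 * β - q) / 3), lt_min (by linarith) (by linarith), ?_, ?_⟩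
    · linarith [min_le_left ((β - q) / 2) ((1 - 2 * β - q) / 3)]
    · linarith [min_le_right ((β - q) / 2) ((1 - 2 * β - q) / 3)]
  have hψ : (q + 2 * δ) / (1 - 2 * β) < 1 := by rwa [div_lt_one hd]
  refine worksWhp_of_agreement hq (by linarith) fun ε hε => ?_
  obtain ⟨m, hm⟩ := exists_pow_lt_of_lt_one hε hψ
  refine ⟨m + 1, δ, 2 * (m + 1 : ℕ), by omega, hδ, by positivity, ?_⟩
  intro h f k _ init S hk hf _
  refine (law_real_not_agreement_le_berserk a b β (m + 1) init S hk hβ hδ.le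
    (by linarith)).trans (add_le_add ?_ le_rfl)
  have h0 : 0 ≤ (q + 2 * δ) / (1 - 2 * β) := by positivity
  calc _ ≤ ((q + 2 * δ) / (1 - 2 * β)) ^ (m + 1) := by gcongr
    _ ≤ ((q + 2 * δ) / (1 - 2 * β)) ^ m := pow_le_pow_of_le_one h0 hψ.le (Nat.le_succ m)
    _ ≤ ε := hm.le

/-! ### A berserk adversary who keeps the honest nodes divided -/

/-- The first `c` nodes have property `true`. -/
def firstNodes {h : ℕ} (c : ℕ) (j : Fin h) : Bool := decide ((j : ℕ) < c)

theorem card_firstNodes {h c : ℕ} (hc : c ≤ h) :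
    (Finset.univ.filter fun j : Fin h => firstNodes c j = true).card = c := by
  simp only [firstNodes, decide_eq_true_eq, Fin.card_filter_val_lt, min_eq_right hc]

/-- The adversary tells the first `c` honest nodes that all his nodes have opinion `1`, and the
others that they have opinion `0`. -/
def splitStrategy (h f k c : ℕ) : Strategy h f k where
  answer _ _ _ _ j _ _ := firstNodes c j
  measurable_answer _ := measurable_const

section Split

variable {h f k : ℕ} (a b β : ℝ) (m₀ ℓ : ℕ) (init : Fin h → Bool) (c : ℕ)

/-- The honest nodes that do not have the opinion that the adversary suggests to them. -/
def disobedient (t : ℕ) (ω : ℕ → RoundNoise h f k) : Set (Fin h) :=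
  {j | opinions a b β m₀ ℓ init (splitStrategy h f k c) ω t j ≠ firstNodes c j}

/-- The honest nodes that see an untypical number of answers `1`. -/
def misled (δ : ℝ) (e : Bool) (t : ℕ) (ω : ℕ → RoundNoise h f k) : Set (Fin h) :=
  {j | Deviates δ (ballot a b β m₀ ℓ init (splitStrategy h f k c) e t ω) (ω t).2 j}

variable {ω : ℕ → RoundNoise h f k}

theorem ones_splitStrategy (t : ℕ) (j : Fin h) :
    ones a b β m₀ ℓ init (splitStrategy h f k c) ω t j
      = hits (ballot a b β m₀ ℓ init (splitStrategy h f k c) (firstNodes c j) t ω) (ω t).2 j := rfl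

theorem opinions_succ_splitStrategy (hk : 0 < k) {δ : ℝ} {t : ℕ} {j : Fin h}
    (hℓ : (state a b β m₀ ℓ init (splitStrategy h f k c) ω t j).run < ℓ)
    (hj : ∀ e, j ∉ misled a b β m₀ ℓ init c δ e t ω)
    (h1 : density (ballot a b β m₀ ℓ init (splitStrategy h f k c) false t ω) + δ
      ≤ threshold a b β t (ω t).1.1)
    (h2 : threshold a b β t (ω t).1.1
      ≤ density (ballot a b β m₀ ℓ init (splitStrategy h f k c) true t ω) - δ) :
    opinions a b β m₀ ℓ init (splitStrategy h f k c) ω (t + 1) j = firstNodes c j := by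
  have hk' : (0 : ℝ) < k := by exact_mod_cast hk
  have hs := opinions_succ a b β m₀ init (splitStrategy h f k c) ω hℓ
  rw [ones_splitStrategy] at hs
  have hd := hj (firstNodes c j)
  rw [misled, Set.mem_ofPred_eq, Deviates, not_le, abs_lt] at hd
  cases hf : firstNodes c j with
  | true =>
    rw [hs, le_div_iff₀ hk']
    rw [hf] at hd ⊢
    nlinarith
  | false =>
    rw [← Bool.not_eq_true, hs, not_le, div_lt_iff₀ hk']
    rw [hf] at hd ⊢
    nlinarith

theorem opinions_succ_of_le_run {S : Strategy h f k} {t : ℕ} {j : Fin h}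
    (hℓ : ℓ ≤ (state a b β m₀ ℓ init S ω t j).run) :
    opinions a b β m₀ ℓ init S ω (t + 1) j = opinions a b β m₀ ℓ init S ω t j := by
  simp only [opinions, state, if_pos hℓ]

/-- A node without final opinion decides afresh and obeys unless misled, whatever it did before.
Past disobedience survives only in final opinions. -/
theorem disobedient_succ_subset (hk : 0 < k) {δ : ℝ} {t : ℕ}
    (h1 : density (ballot a b β m₀ ℓ init (splitStrategy h f k c) false t ω) + δ
      ≤ threshold a b β t (ω t).1.1)
    (h2 : threshold a b β t (ω t).1.1
      ≤ density (ballot a b β m₀ ℓ init (splitStrategy h f k c) true t ω) - δ) :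
    disobedient a b β m₀ ℓ init c (t + 1) ω ⊆
      {j | ℓ ≤ (state a b β m₀ ℓ init (splitStrategy h f k c) ω t j).run ∧
        j ∈ disobedient a b β m₀ ℓ init c t ω} ∪ (misled a b β m₀ ℓ init c δ false t ω ∪
          misled a b β m₀ ℓ init c δ true t ω) := by
  intro j hj
  by_contra hcon
  simp only [Set.mem_union, not_or, Set.mem_ofPred_eq, not_and] at hcon
  rcases lt_or_ge (state a b β m₀ ℓ init (splitStrategy h f k c) ω t j).run ℓ with hℓ | hℓ
  · exact hj (opinions_succ_splitStrategy a b β m₀ ℓ init c hk hℓ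
      (by rintro (_ | _); exacts [hcon.2.1, hcon.2.2]) h1 h2)
  · refine hcon.1 hℓ ?_
    rwa [disobedient, Set.mem_ofPred_eq, opinions_succ_of_le_run a b β m₀ ℓ init hℓ] at hj

theorem abs_card_opinions_sub_le (hc : c ≤ h) (t : ℕ) :
    |((Finset.univ.filter fun j => opinions a b β m₀ ℓ init (splitStrategy h f k c) ω t j
      = true).card : ℝ) - c| ≤ (disobedient a b β m₀ ℓ init c t ω).ncard := by
  set op := opinions a b β m₀ ℓ init (splitStrategy h f k c) ω t with hop
  set D := disobedient a b β m₀ ℓ init c t ω with hD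
  have e1 : (Finset.univ.filter fun j => op j = true).card = ({j | op j = true} : Set _).ncard := by
    rw [← Set.ncard_coe_finset]; simp
  have e2 : c = ({j : Fin h | firstNodes c j = true} : Set _).ncard := by
    conv_lhs => rw [← card_firstNodes hc]
    rw [← Set.ncard_coe_finset]; simp
  have h1 : ({j | op j = true} : Set _).ncard
      ≤ ({j : Fin h | firstNodes c j = true} : Set _).ncard + D.ncard := by
    refine (Set.ncard_le_ncard ?_ (Set.toFinite _)).trans (Set.ncard_union_le _ _)
    intro j hj
    by_cases hjD : j ∈ D
    · exact Or.inr hjD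
    · left
      rw [hD, disobedient, Set.mem_ofPred_eq, not_not] at hjD
      rw [Set.mem_ofPred_eq, ← hjD]; exact hj
  have h2 : ({j : Fin h | firstNodes c j = true} : Set _).ncard
      ≤ ({j | op j = true} : Set _).ncard + D.ncard := by
    refine (Set.ncard_le_ncard ?_ (Set.toFinite _)).trans (Set.ncard_union_le _ _)
    intro j hj
    by_cases hjD : j ∈ D
    · exact Or.inr hjD
    · left
      rw [hD, disobedient, Set.mem_ofPred_eq, not_not] at hjD
      rw [Set.mem_ofPred_eq, hop, hjD]; exact hj
  rw [← e1, ← e2] at h1 h2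
  have h1' : ((Finset.univ.filter fun j => op j = true).card : ℝ) ≤ c + D.ncard := by
    exact_mod_cast h1
  have h2' : (c : ℝ) ≤ (Finset.univ.filter fun j => op j = true).card + D.ncard := by
    exact_mod_cast h2
  rw [abs_le]
  constructor <;> linarith

/-- A self-consistent induction: each round adds at most `2ηh` disobedient nodes (one `ηh` for each
ballot), so over `T` rounds proportions move by at most `2Tη`. The interval `[lo, hi]` has this
margin built in, so the next round is again confirming. -/
theorem ncard_disobedient_le (hk : 0 < k) (hh : 0 < h) (hc : c ≤ h) (hℓ : 1 ≤ ℓ) {δ η lo hi : ℝ}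
    {T : ℕ} (hη : 0 ≤ η) (hlo : (c : ℝ) / (h + f) + 2 * T * η + δ ≤ lo)
    (hhi : hi ≤ (c + f : ℝ) / (h + f) - 2 * T * η - δ)
    (hmis : ∀ e, ∀ t < T, ((misled a b β m₀ ℓ init c δ e t ω).ncard : ℝ) ≤ η * h)
    (hX₀ : threshold a b β 0 (ω 0).1.1 ∈
      Set.Icc (density (Sum.elim init fun _ => false : Node h f → Bool) + δ)
        (density (Sum.elim init fun _ => true : Node h f → Bool) - δ))
    (hX : ∀ t < T, t ≠ 0 → threshold a b β t (ω t).1.1 ∈ Set.Icc lo hi) (t : ℕ) (ht : t < T) :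
    ((disobedient a b β m₀ ℓ init c (t + 1) ω).ncard : ℝ) ≤ 2 * (t + 1 : ℕ) * (η * h) := by
  have hh' : (0 : ℝ) < h := by exact_mod_cast hh
  have key : ∀ (s : ℕ) (D : Set (Fin h)), s < T → disobedient a b β m₀ ℓ init c (s + 1) ω ⊆
      D ∪ (misled a b β m₀ ℓ init c δ false s ω ∪ misled a b β m₀ ℓ init c δ true s ω) →
      ((disobedient a b β m₀ ℓ init c (s + 1) ω).ncard : ℝ) ≤ D.ncard + 2 * (η * h) := by
    intro s D hs hsub
    have h1 := (Set.ncard_le_ncard hsub (Set.toFinite _)).trans ((Set.ncard_union_le _ _).trans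
      (Nat.add_le_add_left (Set.ncard_union_le _ _) _))
    have h2 : ((disobedient a b β m₀ ℓ init c (s + 1) ω).ncard : ℝ) ≤ D.ncard
        + ((misled a b β m₀ ℓ init c δ false s ω).ncard
          + (misled a b β m₀ ℓ init c δ true s ω).ncard) := by exact_mod_cast h1
    linarith [hmis false s hs, hmis true s hs]
  induction t with
  | zero =>
    refine (key 0 ∅ ht ?_).trans_eq (by simp)
    have hb : ∀ e, ballot a b β m₀ ℓ init (splitStrategy h f k c) e 0 ω
        = Sum.elim init fun _ => e := fun _ => rfl
    rw [← hb, ← hb, Set.mem_Icc] at hX₀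
    refine (disobedient_succ_subset a b β m₀ ℓ init c hk hX₀.1 hX₀.2).trans
      (Set.union_subset_union_left _ ?_)
    -- No run has length `ℓ ≥ 1` at time 0, so the initial opinions leave no disobedience behind.
    rintro j ⟨hj, -⟩
    rw [run_eq_zero a b β ℓ init _ ω (Nat.zero_le _)] at hj
    omega
  | succ t ih =>
    have ih := ih (by omega)
    have hcard := abs_card_opinions_sub_le a b β m₀ ℓ init c (ω := ω) hc (t + 1)
    have hT : 2 * ((t + 1 : ℕ) : ℝ) * (η * h) ≤ 2 * T * η * (h + f) := by
      have h1 : ((t + 1 : ℕ) : ℝ) ≤ T := by exact_mod_cast ht.le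
      calc 2 * ((t + 1 : ℕ) : ℝ) * (η * h) ≤ 2 * T * (η * (h + f)) := by
            gcongr
            linarith [Nat.cast_nonneg (α := ℝ) f]
        _ = _ := by ring
    have hN : (0 : ℝ) < h + f := by positivity
    rw [abs_le] at hcard
    have hXt := hX (t + 1) ht t.succ_ne_zero
    have hsub : (c : ℝ) / (h + f) + 2 * T * η = (c + 2 * T * η * (h + f)) / (h + f) := by
      field_simp
    have hsub' : (c + f : ℝ) / (h + f) - 2 * T * η = (c + f - 2 * T * η * (h + f)) / (h + f) := by
      field_simp
    refine (key (t + 1) (disobedient a b β m₀ ℓ init c (t + 1) ω) ht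
      ((disobedient_succ_subset a b β m₀ ℓ init c hk ?_ ?_).trans
        (Set.union_subset_union_left _ fun j hj => hj.2))).trans ?_
    · refine le_trans ?_ (hlo.trans hXt.1)
      rw [ballot, density_sum_elim, hsub, add_le_add_iff_right]
      refine div_le_div_of_nonneg_right ?_ hN.le
      simp
      linarith [hcard.2]
    · refine (hXt.2.trans hhi).trans ?_
      rw [ballot, density_sum_elim, hsub', sub_le_sub_iff_right]
      refine div_le_div_of_nonneg_right ?_ hN.le
      simp
      linarith [hcard.1]
    · push_cast at ih ⊢
      linarith

theorem not_agreement_of_ncard_disobedient_lt (hc : c ≤ h) {t : ℕ}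
    (h1 : (disobedient a b β m₀ ℓ init c t ω).ncard < c)
    (h2 : (disobedient a b β m₀ ℓ init c t ω).ncard + c < h) :
    ¬Agreement a b β m₀ ℓ init (splitStrategy h f k c) ω t := by
  rintro ⟨e, he⟩
  have hcard := abs_card_opinions_sub_le a b β m₀ ℓ init c (ω := ω) hc t
  simp only [he] at hcard
  have h1' : ((disobedient a b β m₀ ℓ init c t ω).ncard : ℝ) < c := by exact_mod_cast h1
  have h2' : ((disobedient a b β m₀ ℓ init c t ω).ncard : ℝ) + c < h := by exact_mod_cast h2
  rw [abs_le] at hcard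
  cases e
  · simp at hcard
    linarith [hcard.1]
  · simp at hcard
    linarith [hcard.2]

/-- Agreement needs one of three accidents: a first threshold possibly beyond `a + θ`, many misled
nodes in some round, or a later threshold within `γ` of an end of `[β, 1 - β]`. -/
theorem law_real_agreement_splitStrategy_le [NeZero h] (hk : 0 < k) (hc : c ≤ h) (hℓ : 1 ≤ ℓ)
    (hβ : β < 1 / 2) (hab : a ≤ b) (hab1 : b ≤ a + 1) {δ η γ θ : ℝ} {T : ℕ} (hT : 1 ≤ T)
    (hδ : 0 ≤ δ) (hη : 0 < η) (hγ : 0 ≤ γ) (hθ1 : θ ≤ 1)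
    (hlo : (c : ℝ) / (h + f) + 2 * T * η + δ ≤ β + γ)
    (hhi : 1 - β - γ ≤ (c + f : ℝ) / (h + f) - 2 * T * η - δ)
    (ha : density (Sum.elim init fun _ => false : Node h f → Bool) + δ ≤ a)
    (ha' : a + θ ≤ density (Sum.elim init fun _ => true : Node h f → Bool) - δ)
    (hc1 : 2 * T * (η * h) < c) (hc2 : 2 * T * (η * h) + c < h) :
    (law h f k).real {ω | Agreement a b β m₀ ℓ init (splitStrategy h f k c) ω T}
      ≤ 1 - θ + T * (4 * Real.exp (-2 * k * δ ^ 2) / η + 2 * γ / (1 - 2 * β)) := by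
  have hd : 0 < 1 - 2 * β := by linarith
  have hh : 0 < h := NeZero.pos h
  have hh' : (0 : ℝ) < h := by exact_mod_cast hh
  let S := splitStrategy h f k c
  -- The trivial affine form here, and `Set.univ ∩` in `L`, fit the general interval bounds. Since
  -- `b ≤ a + 1`, a uniform number below `θ` gives a first threshold in `[a, a + θ]`.
  let E₀ : Set (ℕ → RoundNoise h f k) := {ω | (0 : ℝ) + 1 * ((ω 0).1.1 : ℝ) ∈ Set.Icc θ 1}
  let M : ℕ → Bool → Set (ℕ → RoundNoise h f k) := fun t e =>
    {ω | η * h ≤ (misled a b β m₀ ℓ init c δ e t ω).ncard}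
  let L : ℕ → Bool → Set (ℕ → RoundNoise h f k) := fun t e => if t = 0 then ∅ else
    Set.univ ∩ {ω | threshold a b β t (ω t).1.1 ∈
      Set.Icc (if e then 1 - β - γ else β) (if e then 1 - β else β + γ)}
  have hsub : {ω | Agreement a b β m₀ ℓ init S ω T} ⊆
      E₀ ∪ ⋃ p ∈ (Finset.range T ×ˢ (Finset.univ : Finset Bool)), (M p.1 p.2 ∪ L p.1 p.2) := by
    intro ω hω
    by_contra hcon
    simp only [Set.mem_union, not_or, Set.mem_iUnion, Finset.mem_product, Finset.mem_range,
      Finset.mem_univ, and_true, exists_prop, not_exists, not_and] at hcon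
    obtain ⟨hE, hML⟩ := hcon
    have hx1 := (ω 0).1.1.2
    have hxθ : ((ω 0).1.1 : ℝ) < θ := by
      by_contra hge
      exact hE ⟨by linarith, by linarith [hx1.2]⟩
    have hmis : ∀ e, ∀ t < T, ((misled a b β m₀ ℓ init c δ e t ω).ncard : ℝ) ≤ η * h := by
      intro e t ht
      have := (hML (t, e) ht).1
      exact (not_le.1 this).le
    have hX₀ : threshold a b β 0 (ω 0).1.1 ∈ Set.Icc a (a + θ) := by
      rw [threshold, if_pos rfl]
      constructor <;> nlinarith [hx1.1, hx1.2]
    have hX : ∀ t < T, t ≠ 0 →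
        threshold a b β t (ω t).1.1 ∈ Set.Icc (β + γ) (1 - β - γ) := by
      intro t ht ht0
      have hmem := threshold_mem_Icc (a := a) (b := b) hβ ht0 (ω t).1.1
      have h1 := (hML (t, false) ht).2
      have h2 := (hML (t, true) ht).2
      simp only [L, if_neg ht0, Set.univ_inter, Set.mem_ofPred_eq, Set.mem_Icc, not_and_or,
        not_le, if_true, Bool.false_eq_true, if_false] at h1 h2
      constructor
      · rcases h1 with h1 | h1
        · linarith [hmem.1]
        · exact h1.le
      · rcases h2 with h2 | h2
        · exact h2.le
        · linarith [hmem.2]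
    obtain ⟨s, rfl⟩ : ∃ s, T = s + 1 := ⟨T - 1, by omega⟩
    have hD := ncard_disobedient_le a b β m₀ ℓ init c hk hh hc hℓ hη.le hlo hhi hmis
      ⟨ha.trans hX₀.1, hX₀.2.trans ha'⟩ hX s (Nat.lt_succ_self s)
    refine not_agreement_of_ncard_disobedient_lt a b β m₀ ℓ init c hc ?_ ?_ hω
    · exact_mod_cast hD.trans_lt hc1
    · have : ((disobedient a b β m₀ ℓ init c (s + 1) ω).ncard : ℝ) + c < h := by linarith
      exact_mod_cast this
  have hE₀ : (law h f k).real E₀ ≤ 1 - θ := by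
    refine infinitePi_real_le (roundLaw h f k) 0 (E := E₀) ?_ (by linarith) fun ω => ?_
    · exact (measurableSet_Icc (a := θ) (b := (1 : ℝ))).preimage (by fun_prop)
    · simp only [E₀, Set.mem_ofPred_eq, Function.update_self]
      refine prod_real_le_of_left _ _ ?_ fun Q => prod_real_le_of_left _ _ ?_ fun s => ?_
      · exact (measurableSet_Icc (a := θ) (b := (1 : ℝ))).preimage (by fun_prop)
      · exact (measurableSet_Icc (a := θ) (b := (1 : ℝ))).preimage (by fun_prop)
      · simpa using volume_real_affine_mem_Icc_le (c := 0) (d := 1) one_pos hθ1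
  have hM : ∀ t e, (law h f k).real (M t e) ≤ 2 * Real.exp (-2 * k * δ ^ 2) / η := by
    intro t e
    refine (law_real_deviates_le t (measurable_ballot a b β m₀ ℓ init S e t)
      (determinedBefore_ballot a b β m₀ ℓ init S e t) hδ
      (by positivity : 0 < η * h)).trans_eq ?_
    field_simp
  have hL : ∀ t e, (law h f k).real (L t e) ≤ γ / (1 - 2 * β) := by
    intro t e
    by_cases ht : t = 0
    · simp only [L, if_pos ht, measureReal_empty]
      positivity
    · simp only [L, if_neg ht]
      refine (law_real_threshold_mem_Icc_le (L := γ) hβ ht measurable_const measurable_const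
        (fun _ _ _ _ => rfl) (fun _ _ _ _ => rfl) (fun _ => ?_) (fun _ => ?_)
        MeasurableSet.univ (by simp)).trans_eq (by simp)
      · cases e <;> simp [hγ]
      · cases e <;> simp
  refine (measureReal_mono hsub).trans ((measureReal_union_le _ _).trans (add_le_add hE₀ ?_))
  refine (measureReal_biUnion_finset_le _ _).trans ((Finset.sum_le_sum fun p _ =>
    (measureReal_union_le _ _).trans (add_le_add (hM p.1 p.2) (hL p.1 p.2))).trans_eq ?_)
  simp
  ring

end Split

theorem lt_numByz (q : ℝ) (n : ℕ) : q * n - 1 < numByz q n := by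
  linarith [Nat.lt_floor_add_one (q * n), show (numByz q n : ℝ) = (⌊q * n⌋₊ : ℝ) from rfl]

theorem not_worksWhp_berserk {q β a b : ℝ} (hqβ : q < β) (hβ : β < 1 / 2) (ha : 1 / 2 < a)
    (hab : a ≤ b) (hb : b < 1) (hq : 1 - 2 * β ≤ q) : ¬WorksWhp .berserk q β a b := by
  intro hW
  have hd : 0 < 1 - 2 * β := by linarith
  have hq0 : 0 < q := by linarith
  have hq1 : q < 1 := by linarith
  -- `p` is the proportion of initial ones: `p < a < p + q` lets the adversary act on both sides of
  -- thresholds just above `a`, and `p < 1 - q` leaves room among the honest nodes.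
  obtain ⟨p, hp1, hp2⟩ : ∃ p, max 0 (a - q) < p ∧ p < min a (1 - q) :=
    exists_between (max_lt (lt_min (by linarith) (by linarith))
      (lt_min (by linarith) (by linarith)))
  rw [max_lt_iff] at hp1
  rw [lt_min_iff] at hp2
  obtain ⟨θ, hθ⟩ : ∃ θ, θ = (p + q - a) / 4 := ⟨_, rfl⟩
  have hθ0 : 0 < θ := by linarith
  have hθ1 : θ < 1 := by linarith
  -- The accidents after the first threshold will cost less than `θ/4 + θ/4`, so agreement has
  -- probability below `1 - θ/2`, contradicting `1 - θ/4`.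
  obtain ⟨m₀, ℓ, u, k, hm₀, hℓ, hu, hk, -, H⟩ := hW (θ / 4) (by positivity)
  obtain ⟨T, hT⟩ : ∃ T, T = m₀ + ℓ * u := ⟨_, rfl⟩
  have hT1 : 1 ≤ T := by rw [hT]; omega
  rw [← hT] at H
  have hT0 : (0 : ℝ) < T := by exact_mod_cast hT1
  have hT1' : (1 : ℝ) ≤ T := by exact_mod_cast hT1
  obtain ⟨γ, hγ⟩ : ∃ γ, γ = θ * (1 - 2 * β) / (8 * T) := ⟨_, rfl⟩
  have hγ0 : 0 < γ := by rw [hγ]; positivity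
  have hγ1 : γ ≤ 1 := by
    rw [hγ, div_le_one (by positivity)]
    nlinarith
  -- The margin `γ` is spent as `γ/2` for rounding, `γ/4` for `δ` and `γ/4` for `2Tη`. In the first
  -- round, `δ ≤ a - p` and `δ ≤ θ` serve the lower and the upper side.
  obtain ⟨δ, hδ0, hδ1, hδ2, hδ3⟩ : ∃ δ, 0 < δ ∧ δ ≤ a - p ∧ δ ≤ θ ∧ δ ≤ γ / 4 :=
    ⟨min (a - p) (min θ (γ / 4)), lt_min (by linarith) (lt_min hθ0 (by linarith)),
      min_le_left _ _, (min_le_right _ _).trans (min_le_left _ _),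
      (min_le_right _ _).trans (min_le_right _ _)⟩
  obtain ⟨η, hη⟩ : ∃ η, η = γ / (8 * T) := ⟨_, rfl⟩
  have hη0 : 0 < η := by rw [hη]; positivity
  have hTη : 2 * T * η = γ / 4 := by rw [hη]; field_simp; norm_num
  have hexp : Tendsto (fun n => T * (4 * Real.exp (-2 * k n * δ ^ 2) / η)) atTop (𝓝 0) := by
    have h1 : Tendsto (fun n => (2 * δ ^ 2) * (k n : ℝ)) atTop atTop :=
      (tendsto_natCast_atTop_atTop.comp hk).const_mul_atTop (by positivity)
    have h2 := ((Real.tendsto_exp_neg_atTop_nhds_zero.comp h1).const_mul (4 : ℝ)).div_const η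
    have h3 := h2.const_mul (T : ℝ)
    simp only [mul_zero, zero_div] at h3
    refine h3.congr fun n => ?_
    simp only [Function.comp_apply]
    congr 4
    ring
  have hn1 : ∀ᶠ n : ℕ in atTop, 1 / (n : ℝ) < min (γ / 4) θ :=
    (tendsto_one_div_atTop_nhds_zero_nat (𝕜 := ℝ)).eventually
      (gt_mem_nhds (lt_min (by linarith) hθ0))
  have hn2 : ∀ᶠ n : ℕ in atTop, 2 < (1 - q) * (n : ℝ) :=
    (tendsto_natCast_atTop_atTop.const_mul_atTop (by linarith)).eventually_gt_atTop 2
  obtain ⟨n, hW, hkn, hne, hn1, hn2, hn0⟩ := (H.and ((hk.eventually_gt_atTop 0).and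
    ((hexp.eventually (gt_mem_nhds (by positivity : 0 < θ / 4))).and
      (hn1.and (hn2.and (eventually_gt_atTop 0)))))).exists
  have hn0' : (0 : ℝ) < n := by exact_mod_cast hn0
  rw [lt_min_iff, div_lt_iff₀ hn0', div_lt_iff₀ hn0'] at hn1
  have hlt := numByz_lt hq0.le hq1 hn0
  have hf1 := lt_numByz q n
  have hf2 := numByz_le hq0.le n
  have hh := cast_honest hq0.le hq1 n
  have hN : ((n - numByz q n : ℕ) : ℝ) + numByz q n = n := by rw [hh]; ring
  set f := numByz q n
  set h := n - f
  have hne0 : NeZero h := ⟨by omega⟩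
  have hc0 : p * n - 1 < (⌊p * n⌋₊ : ℝ) := by linarith [Nat.lt_floor_add_one (p * n)]
  have hc0' : (⌊p * n⌋₊ : ℝ) ≤ p * n := Nat.floor_le (mul_nonneg hp1.1.le hn0'.le)
  have hc0h : ⌊p * n⌋₊ ≤ h := by
    have : (⌊p * n⌋₊ : ℝ) ≤ h := by rw [hh]; nlinarith
    exact_mod_cast this
  have hc1 : ((h : ℝ) - 1) / 2 ≤ (h / 2 : ℕ) := by
    have : h ≤ 2 * (h / 2) + 1 := by omega
    have : (h : ℝ) ≤ 2 * (h / 2 : ℕ) + 1 := by exact_mod_cast this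
    linarith
  have hc2 : ((h / 2 : ℕ) : ℝ) ≤ (h : ℝ) / 2 := Nat.cast_div_le
  have hh2 : (2 : ℝ) < h := by rw [hh]; linarith
  have hqn : (1 - 2 * β) * n ≤ q * n := mul_le_mul_of_nonneg_right hq hn0'.le
  have hγh : γ * h ≤ h := by nlinarith
  clear_value h f
  have hbound := law_real_agreement_splitStrategy_le (f := f) a b β m₀ ℓ
    (firstNodes (h := h) ⌊p * n⌋₊) (h / 2) hkn (Nat.div_le_self _ _) hℓ hβ hab (by linarith) hT1
    hδ0.le hη0 hγ0.le hθ1.le (by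
      rw [hN, hTη]
      have : ((h / 2 : ℕ) : ℝ) / n ≤ β + γ / 2 := by
        rw [div_le_iff₀ hn0']
        linarith
      linarith) (by
      rw [hN, hTη]
      have : 1 - β - γ / 2 ≤ ((h / 2 : ℕ) + f : ℝ) / n := by
        rw [le_div_iff₀ hn0']
        linarith
      linarith) (by
      rw [density_sum_elim, card_firstNodes hc0h, hN]
      have : ((⌊p * n⌋₊ : ℝ) + if false = true then (f : ℝ) else 0) / n ≤ p := by
        rw [div_le_iff₀ hn0']
        simpa using hc0'
      linarith) (by
      rw [density_sum_elim, card_firstNodes hc0h, hN]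
      have : p + q - 2 * θ ≤ ((⌊p * n⌋₊ : ℝ) + if true = true then (f : ℝ) else 0) / n := by
        rw [le_div_iff₀ hn0', if_pos rfl]
        linarith
      linarith) (by
      rw [← mul_assoc, hTη]
      linarith) (by
      rw [← mul_assoc, hTη]
      linarith)
  have hmain := hW (firstNodes ⌊p * n⌋₊) (splitStrategy h f (k n) (h / 2)) trivial
  have hmono : consensusProb a b β m₀ ℓ (firstNodes ⌊p * n⌋₊) (splitStrategy h f (k n) (h / 2)) T
      ≤ (law h f (k n)).real {ω | Agreement a b β m₀ ℓ (firstNodes ⌊p * n⌋₊)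
        (splitStrategy h f (k n) (h / 2)) ω T} :=
    -- Consensus on a final opinion is in particular agreement of the opinions.
    measureReal_mono fun ω hω => hω.imp fun i hi j => (hi j).2
  have hγ' : T * (2 * γ / (1 - 2 * β)) = θ / 4 := by
    rw [hγ]; field_simp; norm_num
  rw [mul_add, hγ'] at hbound
  linarith

/-! ### The security estimate -/

theorem err_pos (β q : ℝ) (k : ℕ) : 0 < err β q k := Real.exp_pos _

theorem err_le_one (β q : ℝ) (k : ℕ) : err β q k ≤ 1 := by
  rw [err, Real.exp_le_one_iff]
  have : 0 ≤ (k : ℝ) * (β - q) ^ 2 := by positivity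
  linarith

theorem lt_of_phi_pos {β q : ℝ} (hq : q < 1) {k : ℕ} (h : 0 < phi β q k) : q < β := by
  have h1 : 0 < (β - q) / (2 * (1 - q)) := by
    linarith [err_pos β q k, show phi β q k = (β - q) / (2 * (1 - q)) - err β q k from rfl]
  have h2 := (div_pos_iff_of_pos_right (by linarith : 0 < 2 * (1 - q))).1 h1
  linarith

theorem bigW_nonneg {β q : ℝ} (hq : q < 1) (n k m₀ ℓ u : ℕ) : 0 ≤ bigW β q n k m₀ ℓ u := by
  have h0 := (err_pos β q k).le
  have h1 := err_le_one β q k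
  have h2 : 0 ≤ 1 - (1 - err β q k) ^ ℓ :=
    sub_nonneg.2 (pow_le_one₀ (by linarith) (by linarith))
  have h3 : 0 ≤ err β q k / (1 - err β q k) := div_nonneg h0 (by linarith)
  have h4 : 0 ≤ 1 - q := by linarith
  unfold bigW
  positivity

/-! ### Necessary conditions for the security estimate -/

theorem EstimateWorks.lt {kind : AdversaryKind} {q β : ℝ} (hq : q < 1)
    (hE : EstimateWorks kind q β) : q < β := by
  obtain ⟨m₀, ℓ, u, k, -, -, -, -, -, H⟩ := hE 1 one_pos
  obtain ⟨n, hn, -⟩ := H.exists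
  exact lt_of_phi_pos hq hn

/-- Otherwise `ψ_ber ≥ q/(1 - 2β) ≥ 1` for every `n`, so the estimate is never positive. -/
theorem EstimateWorks.lt_of_berserk {q β : ℝ} (hq : q < 1) (hβ : β < 1 / 2)
    (hE : EstimateWorks .berserk q β) : q < 1 - 2 * β := by
  by_contra! hcon
  have hd : 0 < 1 - 2 * β := by linarith
  obtain ⟨m₀, ℓ, u, k, -, -, -, -, -, H⟩ := hE (1 / 2) (by norm_num)
  obtain ⟨n, -, hn⟩ := H.exists
  have h1 := bigW_nonneg (β := β) hq n (k n) m₀ ℓ u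
  have h2 : 1 ≤ psi β q n (k n) .berserk := by
    have h3 : 1 ≤ (q + Real.sqrt (2 * (k n : ℝ)⁻¹ * Real.log (4 * (1 - q) / (β - q))))
        / (1 - 2 * β) := by
      rw [le_div_iff₀ hd]
      linarith [Real.sqrt_nonneg (2 * (k n : ℝ)⁻¹ * Real.log (4 * (1 - q) / (β - q)))]
    exact h3.trans (le_add_of_nonneg_left (by positivity))
  linarith [one_le_pow₀ h2 (n := m₀)]

/-! ### Limits of the terms of the security estimate -/

/-- The limit of `ψ` as the number of nodes and of queries grows. -/
noncomputable def psiLimit (q β : ℝ) : AdversaryKind → ℝ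
  | .cautious => 0
  | .berserk => q / (1 - 2 * β)

theorem tendsto_psi {q β : ℝ} (hq : q < 1) (hqβ : q < β) (kind : AdversaryKind) {k : ℕ → ℕ}
    (hk : Tendsto k atTop atTop) :
    Tendsto (fun n => psi β q n (k n) kind) atTop (𝓝 (psiLimit q β kind)) := by
  have hc : 0 < (1 / 8) * ((β - q) ^ 2 / (4 * (1 - q))) := by
    have h1 : 0 < β - q := by linarith
    have h2 : 0 < 1 - q := by linarith
    positivity
  have h1 : Tendsto (fun n : ℕ => 2 * Real.exp (-(1 / 8) * n * ((β - q) ^ 2 / (4 * (1 - q)))))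
      atTop (𝓝 0) := by
    have := (Real.tendsto_exp_neg_atTop_nhds_zero.comp
      (tendsto_natCast_atTop_atTop.const_mul_atTop hc)).const_mul (2 : ℝ)
    rw [mul_zero] at this
    refine this.congr fun n => ?_
    simp only [Function.comp_apply]
    congr 2
    ring
  have h2 : Tendsto (fun n : ℕ =>
      Real.sqrt (2 * (k n : ℝ)⁻¹ * Real.log (4 * (1 - q) / (β - q)))) atTop (𝓝 0) := by
    have := (((tendsto_inv_atTop_nhds_zero_nat (𝕜 := ℝ)).comp hk).const_mul (2 : ℝ)).mul_const
      (Real.log (4 * (1 - q) / (β - q)))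
    rw [mul_zero, zero_mul] at this
    have h3 := (Real.continuous_sqrt.tendsto 0).comp this
    rwa [Real.sqrt_zero] at h3
  cases kind with
  | cautious =>
    have h3 := h1.add (h2.const_mul (1 - 2 * β)⁻¹)
    rwa [mul_zero, add_zero] at h3
  | berserk =>
    have h3 := h1.add ((h2.const_add q).div_const (1 - 2 * β))
    rwa [add_zero, zero_add] at h3

theorem tendsto_err {q β : ℝ} (hqβ : q < β) {k : ℕ → ℕ} (hk : Tendsto k atTop atTop) :
    Tendsto (fun n => err β q (k n)) atTop (𝓝 0) := by
  have h1 : 0 < β - q := by linarith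
  have := Real.tendsto_exp_neg_atTop_nhds_zero.comp
    ((tendsto_natCast_atTop_atTop.comp hk).const_mul_atTop
      (by positivity : 0 < (1 / 2) * (β - q) ^ 2))
  refine this.congr fun n => ?_
  simp only [Function.comp_apply, err]
  congr 1
  ring

theorem tendsto_phi {q β : ℝ} (hqβ : q < β) {k : ℕ → ℕ} (hk : Tendsto k atTop atTop) :
    Tendsto (fun n => phi β q (k n)) atTop (𝓝 ((β - q) / (2 * (1 - q)))) := by
  simpa [phi] using (tendsto_err hqβ hk).const_sub ((β - q) / (2 * (1 - q)))

/-- For `ℓ = 2`, `u = 1` the bracket is `e(2 - e) + e/(1 - e)` with `e = err`, and `n e → 0` for `k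
= √n`. With `ℓ = 1` the second summand would be 1 and `W` would grow like `n`. -/
theorem tendsto_bigW {q β : ℝ} (hq : q < 1) (hqβ : q < β) (m₀ : ℕ) :
    Tendsto (fun n => bigW β q n (Nat.sqrt n) m₀ 2 1) atTop (𝓝 0) := by
  have hβq : 0 < β - q := by linarith
  have hq' : 0 < 1 - q := by linarith
  have he := tendsto_err hqβ tendsto_natSqrt_atTop
  have hne : Tendsto (fun n : ℕ => (n : ℝ) * err β q (Nat.sqrt n)) atTop (𝓝 0) := by
    refine (tendsto_mul_exp_natSqrt (c := 1 / 2 * (β - q) ^ 2) (by positivity)).congr fun n => ?_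
    rw [err]
    congr 2
    ring
  have hexp : Tendsto (fun n : ℕ => Real.exp (-2 * (1 - q) * n * phi β q (Nat.sqrt n) ^ 2))
      atTop (𝓝 0) := by
    have h1 : Tendsto (fun n : ℕ => (2 * (1 - q)) * ((n : ℝ) * phi β q (Nat.sqrt n) ^ 2))
        atTop atTop :=
      (tendsto_natCast_atTop_atTop.atTop_mul_pos
        (by positivity : 0 < ((β - q) / (2 * (1 - q))) ^ 2)
        ((tendsto_phi hqβ tendsto_natSqrt_atTop).pow 2)).const_mul_atTop (by positivity)
    refine (Real.tendsto_exp_neg_atTop_nhds_zero.comp h1).congr fun n => ?_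
    simp only [Function.comp_apply]
    congr 1
    ring
  have h1 := ((hne.mul (he.const_sub 2)).add
    (hne.div (he.const_sub 1) (by norm_num))).const_mul (1 - q)
  have h2 := h1.add (hexp.const_mul ((m₀ : ℝ) + (2 : ℕ) * (1 : ℕ)))
  simp only [zero_mul, zero_div, add_zero, mul_zero] at h2
  refine h2.congr fun n => ?_
  simp only [bigW, Pi.div_apply]
  ring

theorem estimateWorks_of_psiLimit {kind : AdversaryKind} {q β : ℝ} (hq : q < 1) (hqβ : q < β)
    (h0 : 0 ≤ psiLimit q β kind) (h1 : psiLimit q β kind < 1) : EstimateWorks kind q β := by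
  intro ε hε
  obtain ⟨m, hm⟩ := exists_pow_lt_of_lt_one hε h1
  refine ⟨m + 1, 2, 1, Nat.sqrt, by omega, by omega, le_rfl, tendsto_natSqrt_atTop,
    tendsto_natSqrt_div_self, ?_⟩
  have hφ : 0 < (β - q) / (2 * (1 - q)) := div_pos (by linarith) (by linarith)
  have hlim := (tendsto_bigW hq hqβ (m + 1)).add
    ((tendsto_psi hq hqβ kind tendsto_natSqrt_atTop).pow (m + 1))
  rw [zero_add] at hlim
  -- The exponent is `m + 1` since `m₀ ≥ 1` is required and `m` may be 0.
  have hlt : psiLimit q β kind ^ (m + 1) < ε :=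
    (pow_le_pow_of_le_one h0 h1.le (Nat.le_succ m)).trans_lt hm
  filter_upwards [hlim.eventually (gt_mem_nhds hlt),
    (tendsto_phi hqβ tendsto_natSqrt_atTop).eventually (lt_mem_nhds hφ)] with n hn1 hn2
  exact ⟨hn2, by linarith⟩

theorem estimateWorks_cautious_iff {q β : ℝ} (hq : q < 1) :
    EstimateWorks .cautious q β ↔ q < β :=
  ⟨EstimateWorks.lt hq, fun h => estimateWorks_of_psiLimit hq h le_rfl one_pos⟩

theorem estimateWorks_berserk_iff {q β : ℝ} (hq0 : 0 ≤ q) (hq : q < 1) (hβ : β < 1 / 2) :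
    EstimateWorks .berserk q β ↔ q < β ∧ q < 1 - 2 * β := by
  have hd : 0 < 1 - 2 * β := by linarith
  exact ⟨fun h => ⟨h.lt hq, h.lt_of_berserk hq hβ⟩, fun h =>
    estimateWorks_of_psiLimit hq h.1 (div_nonneg hq0 hd.le) ((div_lt_one hd).2 h.2)⟩

theorem worksWhp_berserk_iff {q β a b : ℝ} (hq : 0 ≤ q) (hqβ : q < β) (hβ : β < 1 / 2)
    (ha : 1 / 2 < a) (hab : a ≤ b) (hb : b < 1) : WorksWhp .berserk q β a b ↔ q < 1 - 2 * β :=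
  ⟨fun h => by
    by_contra! hcon
    exact not_worksWhp_berserk hqβ hβ ha hab hb hcon h, worksWhp_berserk hq hqβ hβ⟩

end RandomThreshold

theorem mainTheorem5 :
    -- What is needed, for the security estimate to be of use.
    (∀ q β : ℝ, 0 ≤ q → q < 1 → 0 < β → β < 1 / 2 →
      (RandomThreshold.EstimateWorks .cautious q β ↔ q < β) ∧
      (RandomThreshold.EstimateWorks .berserk q β ↔ q < β ∧ q < 1 - 2 * β)) ∧
    -- What the protocol achieves for given `q < β`.
    (∀ q β a b : ℝ, 0 ≤ q → q < β → β < 1 / 2 → 1 / 2 < a → a ≤ b → b < 1 →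
      RandomThreshold.WorksWhp .cautious q β a b ∧
      (RandomThreshold.WorksWhp .berserk q β a b ↔ q < 1 - 2 * β)) ∧
    -- Cautious adversary: any `q < 1/2`, with `β` sufficiently close to `1/2`.
    (∀ q : ℝ, 0 ≤ q → q < 1 / 2 → ∃ β₀ < (1 / 2 : ℝ), ∀ β : ℝ, β₀ < β → β < 1 / 2 →
      RandomThreshold.EstimateWorks .cautious q β ∧
      ∀ a b : ℝ, 1 / 2 < a → a ≤ b → b < 1 → RandomThreshold.WorksWhp .cautious q β a b) ∧
    -- Berserk adversary: `β = 1/3` works for any `q < 1/3`.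
    (∀ q : ℝ, 0 ≤ q → q < 1 / 3 →
      RandomThreshold.EstimateWorks .berserk q (1 / 3) ∧
      ∀ a b : ℝ, 1 / 2 < a → a ≤ b → b < 1 →
        RandomThreshold.WorksWhp .berserk q (1 / 3) a b) ∧
    -- Berserk adversary: only `q < 1/3` is possible.
    (∀ q : ℝ, 0 ≤ q → q < 1 →
      ((∃ β : ℝ, 0 < β ∧ β < 1 / 2 ∧ RandomThreshold.EstimateWorks .berserk q β) ↔ q < 1 / 3) ∧
      ∀ a b : ℝ, 1 / 2 < a → a ≤ b → b < 1 →
        ((∃ β : ℝ, q < β ∧ β < 1 / 2 ∧ RandomThreshold.WorksWhp .berserk q β a b) ↔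
          q < 1 / 3)) := by
  open RandomThreshold in
  refine ⟨fun q β hq hq1 _ hβ => ⟨estimateWorks_cautious_iff hq1,
      estimateWorks_berserk_iff hq hq1 hβ⟩,
    fun q β a b hq hqβ hβ ha hab hb => ⟨worksWhp_cautious hq (by linarith) hβ,
      worksWhp_berserk_iff hq hqβ hβ ha hab hb⟩,
    fun q hq hq2 => ⟨q, hq2, fun β hqβ hβ => ⟨(estimateWorks_cautious_iff (by linarith)).2 hqβ,
      fun a b _ _ _ => worksWhp_cautious hq (by linarith) hβ⟩⟩,
    fun q hq hq3 => ⟨(estimateWorks_berserk_iff hq (by linarith) (by norm_num)).2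
        ⟨hq3, by linarith⟩,
      fun a b _ _ _ => worksWhp_berserk hq hq3 (by norm_num) (by linarith)⟩,
    fun q hq hq1 => ⟨⟨?_, fun hq3 => ⟨1 / 3, by norm_num, by norm_num,
        (estimateWorks_berserk_iff hq hq1 (by norm_num)).2 ⟨hq3, by linarith⟩⟩⟩,
      fun a b ha hab hb => ⟨?_, fun hq3 => ⟨1 / 3, hq3, by norm_num,
        worksWhp_berserk hq hq3 (by norm_num) (by linarith)⟩⟩⟩⟩
  -- Adding twice `q < β` to `q < 1 - 2β` gives `3q < 1`; the same holds in the case below.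
  · rintro ⟨β, -, hβ, hE⟩
    obtain ⟨h1, h2⟩ := (estimateWorks_berserk_iff hq hq1 hβ).1 hE
    linarith
  · rintro ⟨β, hqβ, hβ, hW⟩
    have h2 := (worksWhp_berserk_iff hq hqβ hβ ha hab hb).1 hW
    linarith
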